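/- Let $A$ be an (additively written) abelian group with torsion subgroup $T=T(A)$. Assume that the torsion-free rank $r_0(A)$ is finite and that either $T$ is bounded (i.e. $nT=0$ for some integer $n>0$) or $A/T$ is finitely generated. An automorphism $\gamma$ of a group $G$ is called inertial if each subgroup $H$ of $G$ has finite index in the subgroup generated by $H$ and its image under $\gamma$. For an abelian group $B$, let $\mathrm{IAut}(B)$ denote the subgroup of $\mathrm{Aut}(B)$ generated by all inertial automorphisms of $B$; and let $\mathrm{IAut}_1(A)$ be the set of all inertial automorphisms of $A$ that act as the identity map on $A/T$. Let $\Sigma=\mathrm{St}(A,T)$ be the group of all automorphisms of $A$ that act as the identity map on both $A/T$ and $T$ (a normal subgroup of $\mathrm{Aut}(A)$). Then $\Sigma$ is a periodic abelian group, and there is a subgroup $\Gamma_1$ of $\mathrm{Aut}(A)$ such that $\mathrm{IAut}_1(A)$ is a subgroup of $\mathrm{Aut}(A)$, $\mathrm{IAut}_1(A)=\Sigma\rtimes\Gamma_1$ (internal semidirect product, with $\Sigma$ normal), $\Gamma_1\simeq \mathrm{IAut}(T)$, and for every $\gamma\in\Gamma_1$ the automorphism of $\Sigma$ induced by conjugation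 by $\gamma$ is inertial. -/

import Mathlib

/-- An automorphism `f` of an (additively written) group `G` is inertial if every subgroup `H` of
`G` has finite index in the subgroup `H + f(H)` generated by `H` and its image. -/
def IsInertial {G : Type*} [AddGroup G] (f : G ≃+ G) : Prop :=
  ∀ H : AddSubgroup G,
    Finite (↥(H ⊔ H.map f.toAddMonoidHom) ⧸ H.addSubgroupOf (H ⊔ H.map f.toAddMonoidHom))

/-- The automorphism group `Aut(A)` of an abelian group `A`, under composition.
(The additive automorphisms of `A` are exactly its `ℤ`-linear automorphisms.) -/
abbrev AbAut (A : Type*) [AddCommGroup A] : Type _ := A ≃ₗ[ℤ] A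

/-- `IAut(A)`: the subgroup of `Aut(A)` generated by all inertial automorphisms. -/
def IAut (A : Type*) [AddCommGroup A] : Subgroup (AbAut A) :=
  Subgroup.closure {f : AbAut A | IsInertial f.toAddEquiv}

/-- `IAut₁(A)`: the set of the inertial automorphisms of `A` that act as the identity map
on `A/T(A)`. -/
def IAutOne (A : Type*) [AddCommGroup A] : Set (AbAut A) :=
  {f : AbAut A | IsInertial f.toAddEquiv ∧ ∀ a : A, f a - a ∈ AddCommGroup.torsion A}

/-- `St(A, X)`: the stability group of the series `A ≥ X ≥ 0`, i.e. the group of all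
automorphisms `f` of `A` with `[A, f] ≤ X` and `[X, f] = 0`. -/
def stabilityGroup (A : Type*) [AddCommGroup A] (X : AddSubgroup A) : Subgroup (AbAut A) where
  carrier := {f : AbAut A | (∀ a : A, f a - a ∈ X) ∧ ∀ x ∈ X, f x = x}
  one_mem' := by
    refine ⟨fun a => ?_, fun x _ => rfl⟩
    simp
  mul_mem' := by
    rintro f g ⟨hf1, hf2⟩ ⟨hg1, hg2⟩
    refine ⟨fun a => ?_, fun x hx => ?_⟩
    · have h := X.add_mem (hf1 (g a)) (hg1 a)
      simpa using h
    · rw [LinearEquiv.mul_apply, hg2 x hx, hf2 x hx]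
  inv_mem' := by
    rintro f ⟨hf1, hf2⟩
    have hf : ∀ a, f (f⁻¹ a) = a := fun a => f.apply_symm_apply a
    have hf' : ∀ a, f⁻¹ (f a) = a := fun a => f.symm_apply_apply a
    refine ⟨fun a => ?_, fun x hx => ?_⟩
    · have h := X.neg_mem (hf1 (f⁻¹ a))
      rwa [hf, neg_sub] at h
    · have h := congrArg (fun a => f⁻¹ a) (hf2 x hx)
      simp only [hf'] at h
      exact h.symm

/-- The stability group of `A ≥ T(A) ≥ 0` is a normal subgroup of `Aut(A)`, so that `Aut(A)` acts
on it via conjugation. -/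
instance stabilityGroup_torsion_normal (A : Type*) [AddCommGroup A] :
    (stabilityGroup A (AddCommGroup.torsion A)).Normal where
  conj_mem := by
    have key : ∀ (g : AbAut A) (x : A), x ∈ AddCommGroup.torsion A →
        g x ∈ AddCommGroup.torsion A := by
      intro g x hx
      exact AddMonoidHom.isOfFinAddOrder g.toLinearMap.toAddMonoidHom hx
    rintro f ⟨hf1, hf2⟩ g
    have hg : ∀ a, g (g⁻¹ a) = a := fun a => g.apply_symm_apply a
    refine ⟨fun a => ?_, fun x hx => ?_⟩
    · have h := key g _ (hf1 (g⁻¹ a))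
      rwa [map_sub, hg] at h
    · have h := hf2 _ (key g⁻¹ x hx)
      rw [LinearEquiv.mul_apply, LinearEquiv.mul_apply, h, hg]

/-- The subset `S` of a group `G` is (the underlying set of) a subgroup of `G` which is the internal
semidirect product `N ⋊ K` of its normal subgroup `N` and its subgroup `K`. -/
def IsInternalSemidirect {G : Type*} [Group G] (S : Set G) (N K : Subgroup G) : Prop :=
  (((N ⊔ K : Subgroup G) : Set G) = S) ∧ (N.subgroupOf (N ⊔ K)).Normal ∧ N ⊓ K = ⊥

/-! Write `T` for the torsion subgroup. The hypotheses yield an `n` with `nT = 0` (`n = 0` when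
`A/T` is finitely generated and `T` may be unbounded) such that every subgroup `H` of `A` is
generated by `H ∩ T`, `nH` and a finite set (`exists_finite_generation_mod`). A homomorphism from
`A` to `T` kills `nH` and sends finite sets into finite subgroups, so up to a finite subgroup the
image of `H` is that of `H ∩ T`. Hence each `σ - 1` with `σ ∈ Σ` has finite image, so `Σ` is
periodic, and an automorphism trivial on `A/T` is inertial as soon as its restriction to `T` is.

Moreover `T` is a direct summand: `A/T` tensored with `ℤ/n` is flat and finitely generated, hence
projective, and `T ∩ nA = 0`. Extending automorphisms of `T` by the identity on a complement embeds
`Aut(T)` in `Aut(A)`. Since the inertial automorphisms of a torsion group already form a group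
(`mem_IAut_iff`), the image of `IAut(T)` serves as `Γ₁`.

For the conjugation action, fix a finite set `S` generating `A` modulo `T` and `nA`. Evaluating `σ -
1` on `S` embeds `Σ` in the power `T^S` and turns conjugation by `γ` into the coordinatewise action
of `γ`. So an inertial endomorphism of a torsion group must be shown to act inertially on finite
powers (`FinInertial.compLeft`). The danger is that different coordinates call for different
multipliers. But on suitable pieces of the group `γ` sends each `x` to a multiple of `x` modulo one
fixed finite subgroup, and such a map is multiplication by a single integer on each finite set
(`exists_uniform_scalar`). The pieces are the elements of order coprime to `|F|`, for a finite
control subgroup `F`, and for each prime dividing `|F|` a bounded part and a part with finite socle.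
-/

/-! ### Containment up to a finite subgroup -/

/-- `W` is contained in `H` up to a finite subgroup. -/
def AlmostLE {B : Type*} [AddCommGroup B] (W H : AddSubgroup B) : Prop :=
  ∃ F : AddSubgroup B, Finite F ∧ W ≤ H ⊔ F

/-- Endomorphisms mapping each subgroup into itself up to a finite subgroup. -/
def FinInertial {B : Type*} [AddCommGroup B] (γ : B →+ B) : Prop :=
  ∀ H : AddSubgroup B, AlmostLE (H.map γ) H

open scoped Pointwise in
theorem finite_addSubgroup_sup {B : Type*} [AddCommGroup B] {F G : AddSubgroup B}
    (hF : Finite F) (hG : Finite G) : Finite ↥(F ⊔ G) := by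
  have hs : ((F : Set B) + (G : Set B)).Finite := Set.Finite.add (Set.toFinite _) (Set.toFinite _)
  rw [← AddSubgroup.add_normal] at hs
  exact hs

theorem finite_addSubgroup_map {B C : Type*} [AddCommGroup B] [AddCommGroup C] {F : AddSubgroup B}
    (hF : Finite F) (f : B →+ C) : Finite ↥(F.map f) :=
  (Set.toFinite ((F : Set B))).image f

theorem finite_closure_of_isAddTorsion {B : Type*} [AddCommGroup B] (hB : IsAddTorsion B)
    {s : Set B} (hs : s.Finite) : Finite (AddSubgroup.closure s) := by
  have : AddGroup.FG (AddSubgroup.closure s) :=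
    (AddGroup.fg_iff_addSubgroup_fg _).2 ⟨hs.toFinset, by simp⟩
  exact AddCommGroup.finite_of_fg_isAddTorsion _ (hB.addSubgroup _)

namespace AlmostLE

variable {B C : Type*} [AddCommGroup B] [AddCommGroup C]

theorem of_le {W H : AddSubgroup B} (h : W ≤ H) : AlmostLE W H :=
  ⟨⊥, inferInstance, h.trans le_sup_left⟩

theorem of_finite {W H : AddSubgroup B} (h : Finite W) : AlmostLE W H :=
  ⟨W, h, le_sup_right⟩

theorem sup {W₁ W₂ H : AddSubgroup B} (h₁ : AlmostLE W₁ H) (h₂ : AlmostLE W₂ H) :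
    AlmostLE (W₁ ⊔ W₂) H := by
  obtain ⟨F₁, hF₁, h₁⟩ := h₁
  obtain ⟨F₂, hF₂, h₂⟩ := h₂
  exact ⟨F₁ ⊔ F₂, finite_addSubgroup_sup hF₁ hF₂,
    sup_le (h₁.trans (sup_le_sup_left le_sup_left _)) (h₂.trans (sup_le_sup_left le_sup_right _))⟩

theorem trans {W₁ W₂ H : AddSubgroup B} (h₁ : AlmostLE W₁ W₂) (h₂ : AlmostLE W₂ H) :
    AlmostLE W₁ H := by
  obtain ⟨F₁, hF₁, h₁⟩ := h₁
  obtain ⟨F₂, hF₂, h₂⟩ := h₂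
  refine ⟨F₂ ⊔ F₁, finite_addSubgroup_sup hF₂ hF₁, h₁.trans ?_⟩
  rw [← sup_assoc]
  exact sup_le_sup_right h₂ _

theorem mono {W W' H H' : AddSubgroup B} (h : AlmostLE W H) (hW : W' ≤ W) (hH : H ≤ H') :
    AlmostLE W' H' :=
  (of_le hW).trans (h.trans (of_le hH))

theorem map {W H : AddSubgroup B} (h : AlmostLE W H) (f : B →+ C) :
    AlmostLE (W.map f) (H.map f) := by
  obtain ⟨F, hF, h⟩ := h
  refine ⟨F.map f, finite_addSubgroup_map hF f, ?_⟩
  rw [← AddSubgroup.map_sup]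
  exact AddSubgroup.map_mono h

theorem relIndex_ne_zero {W H : AddSubgroup B} (h : AlmostLE W H) : H.relIndex W ≠ 0 := by
  obtain ⟨F, hF, h⟩ := h
  intro h0
  have := AddSubgroup.relIndex_eq_zero_of_le_right h h0
  rw [AddSubgroup.relIndex_sup_left] at this
  have h2 := AddSubgroup.relIndex_dvd_card H F
  rw [this, zero_dvd_iff] at h2
  exact Nat.card_pos.ne' h2

/-- In a torsion group finitely many coset representatives generate a finite subgroup, so finite
index becomes containment up to a finite summand. -/
theorem of_relIndex_ne_zero (hB : IsAddTorsion B) {W H : AddSubgroup B} (h : H.relIndex W ≠ 0) :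
    AlmostLE W H := by
  have hfin : Finite (W ⧸ H.addSubgroupOf W) :=
    haveI : (H.addSubgroupOf W).FiniteIndex := ⟨h⟩
    AddSubgroup.finite_quotient_of_finiteIndex
  let s : Set B := Set.range (fun q : W ⧸ H.addSubgroupOf W => ((Quotient.out q : W) : B))
  refine ⟨AddSubgroup.closure s, finite_closure_of_isAddTorsion hB (Set.finite_range _), ?_⟩
  intro w hw
  let q : W ⧸ H.addSubgroupOf W := QuotientAddGroup.mk ⟨w, hw⟩
  have hq : (QuotientAddGroup.mk (Quotient.out q) : W ⧸ H.addSubgroupOf W) = q :=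
    Quotient.out_eq' q
  have h1 := QuotientAddGroup.eq.1 hq
  rw [AddSubgroup.mem_addSubgroupOf] at h1
  refine AddSubgroup.mem_sup.2 ⟨_, h1, _, AddSubgroup.subset_closure ⟨q, rfl⟩, ?_⟩
  simp

end AlmostLE

/-! ### Inertia in terms of almost containment -/

theorem isInertial_iff_relIndex {G : Type*} [AddCommGroup G] (f : G ≃+ G) :
    IsInertial f ↔ ∀ H : AddSubgroup G, H.relIndex (H.map f.toAddMonoidHom) ≠ 0 := by
  refine forall_congr' fun H => ?_
  rw [← AddSubgroup.relIndex_sup_left, AddSubgroup.relIndex, ← AddSubgroup.finiteIndex_iff,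
    AddSubgroup.finiteIndex_iff_finite_quotient]

theorem FinInertial.isInertial {G : Type*} [AddCommGroup G] {f : G ≃+ G}
    (hf : FinInertial f.toAddMonoidHom) : IsInertial f :=
  (isInertial_iff_relIndex f).2 fun H => (hf H).relIndex_ne_zero

theorem IsInertial.finInertial {G : Type*} [AddCommGroup G] (hG : IsAddTorsion G) {f : G ≃+ G}
    (hf : IsInertial f) : FinInertial f.toAddMonoidHom := fun H =>
  AlmostLE.of_relIndex_ne_zero hG ((isInertial_iff_relIndex f).1 hf H)

/-- Inertia can be tested through an equivariant embedding into an abelian group. -/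
theorem FinInertial.isInertial_of_injective {G B : Type*} [AddGroup G] [AddCommGroup B]
    {f : G ≃+ G} {γ : B →+ B} (hγ : FinInertial γ) (j : G →+ B) (hj : Function.Injective j)
    (h : ∀ x, j (f x) = γ (j x)) : IsInertial f := by
  intro H
  rw [← AddSubgroup.finiteIndex_iff_finite_quotient, AddSubgroup.finiteIndex_iff]
  change H.relIndex _ ≠ 0
  rw [← AddSubgroup.relIndex_map_map_of_injective _ _ hj, AddSubgroup.map_sup,
    AddSubgroup.relIndex_sup_left]
  have e : (H.map f.toAddMonoidHom).map j = (H.map j).map γ := by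
    rw [AddSubgroup.map_map, AddSubgroup.map_map]
    congr 1
    ext x
    exact h x
  rw [e]
  exact (hγ _).relIndex_ne_zero

/-! ### Inertial endomorphisms of torsion groups -/

namespace FinInertial

variable {B : Type*} [AddCommGroup B] {γ : B →+ B}

/-- If each `⟨u i⟩` meets the previous stage `F i` of a chain only in `F 0`, and the chain
absorbs `u i` and `γ (u i)`, then `γ (u i) ∈ F i + ⟨u i⟩` for some `i`. -/
theorem exists_mem_of_chain (hγ : FinInertial γ) (F : ℕ → AddSubgroup B) (u : ℕ → B)
    (hmono : Monotone F) (hu : ∀ i, u i ∈ F (i + 1)) (hγu : ∀ i, γ (u i) ∈ F (i + 1))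
    (hind : ∀ i, F i ⊓ AddSubgroup.zmultiples (u i) ≤ F 0) :
    ∃ i, γ (u i) ∈ F i ⊔ AddSubgroup.zmultiples (u i) := by
  -- Inertia is tested on one subgroup only: the union of the `K n`, generated by `F 0` and all the
  -- `u i`.
  let K : ℕ → AddSubgroup B := fun n =>
    Nat.rec (F 0) (fun i X => X ⊔ AddSubgroup.zmultiples (u i)) n
  have K0 : K 0 = F 0 := rfl
  have KS : ∀ n, K (n + 1) = K n ⊔ AddSubgroup.zmultiples (u n) := fun n => rfl
  have Kmono : Monotone K := monotone_nat_of_le_succ fun n => by rw [KS]; exact le_sup_left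
  have KF : ∀ n, K n ≤ F n := by
    intro n
    induction n with
    | zero => exact K0.le
    | succ n ih =>
      rw [KS]
      refine sup_le (ih.trans (hmono n.le_succ)) ?_
      rw [AddSubgroup.zmultiples_le]
      exact hu n
  -- By independence, generators added after stage `n` contribute nothing new inside `F n`.
  have key : ∀ n N, n ≤ N → K N ⊓ F n ≤ K n := by
    intro n N hN
    induction N, hN using Nat.le_induction with
    | base => exact inf_le_left
    | succ N hN ih =>
      rintro x ⟨hx1, hx2⟩
      change x ∈ K (N + 1) at hx1
      change x ∈ F n at hx2
      rw [KS] at hx1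
      obtain ⟨h, hh, c, hc, rfl⟩ := AddSubgroup.mem_sup.1 hx1
      have hcF : c ∈ F N := by
        have := (F N).sub_mem (hmono hN hx2) (KF N hh)
        simpa using this
      have hc0 : c ∈ K N := by
        have := hind N ⟨hcF, hc⟩
        rw [← K0] at this
        exact Kmono (Nat.zero_le N) this
      exact ih ⟨(K N).add_mem hh hc0, hx2⟩
  have hdir : Directed (· ≤ ·) K := Kmono.directed_le
  obtain ⟨E, hE, hHE⟩ := hγ (⨆ n, K n)
  have huH : ∀ i, u i ∈ ⨆ n, K n := fun i =>
    (le_iSup K (i + 1)) (by rw [KS]; exact AddSubgroup.mem_sup_right (AddSubgroup.mem_zmultiples _))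
  have hex : ∀ i, ∃ e : E, γ (u i) - e ∈ ⨆ n, K n := by
    intro i
    obtain ⟨h, hh, e, he, hs⟩ := AddSubgroup.mem_sup.1 (hHE (AddSubgroup.mem_map_of_mem γ (huH i)))
    exact ⟨⟨e, he⟩, by rw [← hs]; simpa using hh⟩
  choose e he using hex
  -- The errors `e i` lie in the finite group `E`, so two of them agree and cancel in `γ (u i) - γ
  -- (u j)`.
  obtain ⟨i, j, hij, heq⟩ := Finite.exists_ne_map_eq_of_infinite e
  wlog hlt : j < i generalizing i j
  · exact this j i hij.symm heq.symm (lt_of_le_of_ne (not_lt.1 hlt) hij)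
  refine ⟨i, ?_⟩
  have hd : γ (u i) - γ (u j) ∈ ⨆ n, K n := by
    have := (⨆ n, K n).sub_mem (he i) (he j)
    rw [heq] at this
    simpa using this
  obtain ⟨N, hN⟩ := (AddSubgroup.mem_iSup_of_directed hdir).1 hd
  have hjF : γ (u j) ∈ F i := hmono hlt (hγu j)
  have hd2 : γ (u i) - γ (u j) ∈ K (i + 1) :=
    key (i + 1) (max N (i + 1)) (le_max_right _ _)
      ⟨Kmono (le_max_left _ _) hN, (F (i + 1)).sub_mem (hγu i) (hmono i.le_succ hjF)⟩
  rw [KS] at hd2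
  have h3 := sup_le_sup_right (KF i) (AddSubgroup.zmultiples (u i)) hd2
  have := AddSubgroup.add_mem _ h3 (AddSubgroup.mem_sup_left (T := AddSubgroup.zmultiples (u i)) hjF)
  simpa using this

/-- An inertial endomorphism of a torsion group leaves invariant, modulo a fixed finite subgroup
`F`, each cyclic subgroup meeting `F` trivially. -/
theorem exists_finite_control (hγ : FinInertial γ) (hB : IsAddTorsion B) :
    ∃ F : AddSubgroup B, Finite F ∧ ∀ u, F ⊓ AddSubgroup.zmultiples u = ⊥ →
      γ u ∈ F ⊔ AddSubgroup.zmultiples u := by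
  by_contra! hcon
  choose! u hu1 hu2 using hcon
  -- Each stage absorbs its own counterexample and the image of that counterexample.
  let S : {F : AddSubgroup B // Finite F} → {F : AddSubgroup B // Finite F} := fun F =>
    ⟨F.1 ⊔ AddSubgroup.closure {u F.1, γ (u F.1)}, finite_addSubgroup_sup F.2
      (finite_closure_of_isAddTorsion hB (by simp))⟩
  let F : ℕ → {F : AddSubgroup B // Finite F} := fun n => Nat.rec ⟨⊥, inferInstance⟩ (fun _ X => S X) n
  have FS : ∀ n, (F (n + 1)).1 = (F n).1 ⊔ AddSubgroup.closure {u (F n).1, γ (u (F n).1)} :=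
    fun n => rfl
  obtain ⟨i, hi⟩ := hγ.exists_mem_of_chain (fun n => (F n).1) (fun n => u (F n).1)
    (monotone_nat_of_le_succ fun n => by rw [FS]; exact le_sup_left)
    (fun i => by
      rw [FS]; exact AddSubgroup.mem_sup_right (AddSubgroup.subset_closure (by simp)))
    (fun i => by
      rw [FS]; exact AddSubgroup.mem_sup_right (AddSubgroup.subset_closure (by simp)))
    (fun i => by rw [hu1 _ (F i).2]; exact bot_le)
  exact hu2 _ (F i).2 hi

/-- By induction on the order of `x`, a finite invariant subgroup contains `p • x`. Modulo it the
iterates of `x` have order dividing `p`, and if none depended on the preceding ones, the even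
iterates would contradict `exists_mem_of_chain`. -/
theorem exists_finite_invariant (hγ : FinInertial γ) (hB : IsAddTorsion B) (x : B) :
    ∃ F : AddSubgroup B, Finite F ∧ x ∈ F ∧ ∀ y ∈ F, γ y ∈ F := by
  induction hn : addOrderOf x using Nat.strong_induction_on generalizing x with
  | _ n ih =>
  by_cases h1 : n = 1
  · rw [h1, AddMonoid.addOrderOf_eq_one_iff] at hn
    exact ⟨⊥, inferInstance, by simp [hn], by simp⟩
  have hpos : 0 < addOrderOf x := (hB x).addOrderOf_pos
  obtain ⟨p, hp, hpn⟩ := Nat.exists_prime_and_dvd h1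
  have hlt : addOrderOf (p • x) < n := by
    rw [addOrderOf_nsmul_of_dvd hp.pos.ne' (hn ▸ hpn), hn]
    exact Nat.div_lt_self (hn ▸ hpos) hp.one_lt
  obtain ⟨F₀, hF₀, hpx, hinv⟩ := ih _ hlt (p • x) rfl
  have hpow : ∀ i, p • (γ^[i] x) ∈ F₀ := by
    intro i
    induction i with
    | zero => exact hpx
    | succ i hi =>
      rw [Function.iterate_succ_apply', ← map_nsmul]
      exact hinv _ hi
  let S : ℕ → AddSubgroup B := fun k => F₀ ⊔ AddSubgroup.closure ((fun i => γ^[i] x) '' Set.Iio k)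
  have hSmem : ∀ i k, i < k → γ^[i] x ∈ S k := fun i k hik =>
    AddSubgroup.mem_sup_right (AddSubgroup.subset_closure ⟨i, hik, rfl⟩)
  have hSmono : Monotone S := fun a b hab =>
    sup_le_sup_left (AddSubgroup.closure_mono (Set.image_mono (Set.Iio_subset_Iio hab))) _
  suffices hk : ∃ k, γ^[k] x ∈ S k by
    obtain ⟨k, hk⟩ := hk
    refine ⟨S k, finite_addSubgroup_sup hF₀
      (finite_closure_of_isAddTorsion hB ((Set.finite_Iio k).image _)), ?_, ?_⟩
    · rcases Nat.eq_zero_or_pos k with rfl | hk0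
      · exact hk
      · exact hSmem 0 k hk0
    · suffices hle : S k ≤ (S k).comap γ from fun y hy => hle hy
      refine sup_le (fun y hy => AddSubgroup.mem_sup_left (hinv y hy)) ?_
      rw [AddSubgroup.closure_le]
      rintro _ ⟨i, hi, rfl⟩
      change γ (γ^[i] x) ∈ S k
      rw [← Function.iterate_succ_apply' (f := γ)]
      rcases Nat.lt_or_ge (i + 1) k with h | h
      · exact hSmem _ _ h
      · rwa [le_antisymm (Nat.succ_le_of_lt hi) h]
  by_contra! hno
  -- Only even iterates serve as generators: `γ (u i)` is then the odd iterate `2 * i + 1`, which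
  -- enters by stage `i + 1` but should be independent of `S (2 * i + 1)`.
  obtain ⟨i, hi⟩ := hγ.exists_mem_of_chain (fun i => S (2 * i)) (fun i => γ^[2 * i] x)
    (fun a b hab => hSmono (by omega)) (fun i => hSmem _ _ (by omega))
    (fun i => by
      rw [← Function.iterate_succ_apply' (f := γ)]
      exact hSmem _ _ (by omega))
    (by
      rintro i y ⟨hy1, hy2⟩
      obtain ⟨c, rfl⟩ := AddSubgroup.mem_zmultiples_iff.1 hy2
      change c • γ^[2 * i] x ∈ S (2 * i) at hy1
      refine AddSubgroup.mem_sup_left ?_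
      by_cases hc : (p : ℤ) ∣ c
      · obtain ⟨d, rfl⟩ := hc
        rw [mul_comm, mul_smul, natCast_zsmul]
        exact F₀.zsmul_mem (hpow _) d
      · exfalso
        obtain ⟨a, b, hab⟩ := ((Nat.prime_iff_prime_int.1 hp).coprime_iff_not_dvd.2 hc)
        apply hno (2 * i)
        have : γ^[2 * i] x = a • (p • γ^[2 * i] x) + b • (c • γ^[2 * i] x) := by
          rw [← natCast_zsmul, ← mul_smul, ← mul_smul, ← add_smul, hab, one_smul]
        rw [this]
        exact add_mem (zsmul_mem (AddSubgroup.mem_sup_left (hpow _)) _) (zsmul_mem hy1 _))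
  apply hno (2 * i + 1)
  rw [Function.iterate_succ_apply']
  refine (sup_le (hSmono (Nat.le_succ _)) ?_ : _ ≤ S (2 * i + 1)) hi
  rw [AddSubgroup.zmultiples_le]
  exact hSmem _ _ (by omega)

theorem exists_finite_invariant_ge (hγ : FinInertial γ) (hB : IsAddTorsion B)
    {E : AddSubgroup B} (hE : Finite E) :
    ∃ F : AddSubgroup B, Finite F ∧ E ≤ F ∧ ∀ y ∈ F, γ y ∈ F := by
  suffices h : ∀ s : Set B, s.Finite → ∃ F : AddSubgroup B, Finite F ∧ s ⊆ F ∧ ∀ y ∈ F, γ y ∈ F from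
    h E (Set.toFinite _)
  intro s hs
  induction s, hs using Set.Finite.induction_on with
  | empty => exact ⟨⊥, inferInstance, by simp, by simp⟩
  | @insert a s _ _ ih =>
    obtain ⟨F, hF, hsF, hinv⟩ := ih
    obtain ⟨F', hF', haF, hinv'⟩ := hγ.exists_finite_invariant hB a
    refine ⟨F' ⊔ F, finite_addSubgroup_sup hF' hF, ?_, ?_⟩
    · rw [Set.insert_subset_iff]
      exact ⟨AddSubgroup.mem_sup_left haF, fun y hy => AddSubgroup.mem_sup_right (hsF hy)⟩
    · suffices hle : F' ⊔ F ≤ (F' ⊔ F).comap γ from fun y hy => hle hy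
      exact sup_le (fun y hy => AddSubgroup.mem_sup_left (hinv' y hy))
        (fun y hy => AddSubgroup.mem_sup_right (hinv y hy))

/-- Enlarging `H` by a finite invariant subgroup makes it invariant under `f`. Local finiteness then
makes it invariant under the inverse as well, because an injective self-map of a finite set is
surjective. -/
theorem symm {f : B ≃+ B} (hf : FinInertial f.toAddMonoidHom) (hB : IsAddTorsion B) :
    FinInertial f.symm.toAddMonoidHom := by
  intro H
  obtain ⟨E, hE, hHE⟩ := hf H
  obtain ⟨F, hF, hEF, hinv⟩ := hf.exists_finite_invariant_ge hB hE
  have hM : H ⊔ F ≤ (H ⊔ F).comap f.toAddMonoidHom :=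
    sup_le (fun y hy => sup_le_sup_left hEF _ (hHE (AddSubgroup.mem_map_of_mem _ hy)))
      (fun y hy => AddSubgroup.mem_sup_right (hinv y hy))
  refine ⟨F, hF, ?_⟩
  rintro _ ⟨y, hy, rfl⟩
  obtain ⟨G, hG, hyG, hGinv⟩ := hf.exists_finite_invariant hB y
  have hmaps : Set.MapsTo f ((G ⊓ (H ⊔ F) : AddSubgroup B) : Set B) (G ⊓ (H ⊔ F) : AddSubgroup B) :=
    fun z hz => ⟨hGinv z hz.1, hM hz.2⟩
  have : Finite ↥(G ⊓ (H ⊔ F)) :=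
    (Set.toFinite (G : Set B)).subset fun z hz => hz.1
  have hsurj := Finite.surjective_of_injective
    (hmaps.restrict_inj.2 f.injective.injOn)
  obtain ⟨⟨z, hz⟩, hzy⟩ := hsurj ⟨y, hyG, AddSubgroup.mem_sup_left hy⟩
  have hzy : f z = y := congrArg Subtype.val hzy
  have : f.symm y = z := by rw [← hzy, f.symm_apply_apply]
  change f.symm y ∈ _
  rw [this]
  exact hz.2

theorem comp {δ : B →+ B} (hγ : FinInertial γ) (hδ : FinInertial δ) : FinInertial (γ.comp δ) := by
  intro H
  rw [← AddSubgroup.map_map]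
  exact ((hδ H).map γ).trans (hγ H)

theorem id : FinInertial (AddMonoidHom.id B) := fun H => .of_le (by rw [AddSubgroup.map_id])

end FinInertial

/-- On a torsion group, the inertial automorphisms form a group. -/
theorem mem_IAut_iff {B : Type*} [AddCommGroup B] (hB : IsAddTorsion B) {f : AbAut B} :
    f ∈ IAut B ↔ FinInertial f.toAddEquiv.toAddMonoidHom := by
  refine ⟨fun hf => ?_, fun hf => Subgroup.subset_closure hf.isInertial⟩
  induction hf using Subgroup.closure_induction with
  | mem f hf => exact IsInertial.finInertial hB hf
  | one => exact FinInertial.id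
  | mul f g _ _ hf hg => exact hf.comp hg
  | inv f _ hf => exact hf.symm hB

/-! ### Uniform multipliers and finite powers -/

/-- If `g x` is a multiple of `π x` for each `x`, then `g` is multiplication by a single integer
after `π` on each finite set. -/
theorem exists_uniform_scalar {B Q : Type*} [AddCommGroup B] [AddCommGroup Q] (hB : IsAddTorsion B)
    (g π : B →+ Q) (h : ∀ x, g x ∈ AddSubgroup.zmultiples (π x)) {s : Set B} (hs : s.Finite) :
    ∃ c : ℤ, ∀ x ∈ s, g x = c • π x := by
  let R : AddSubgroup Q := (AddSubgroup.closure s).map π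
  have hR : Finite R := finite_addSubgroup_map (finite_closure_of_isAddTorsion hB hs) π
  obtain ⟨⟨_, x₀, hx₀, rfl⟩, hr⟩ :=
    AddMonoid.exists_addOrderOf_eq_exponent (AddMonoid.ExponentExists.of_finite (G := R))
  set n := AddMonoid.exponent R with hn
  rw [← AddSubgroup.addOrderOf_coe] at hr
  change addOrderOf (π x₀) = n at hr
  have hexp : ∀ y ∈ AddSubgroup.closure s, n • π y = 0 := fun y hy =>
    congrArg Subtype.val (AddMonoid.exponent_nsmul_eq_zero
      (⟨π y, y, hy, rfl⟩ : R))
  obtain ⟨c, hc⟩ := AddSubgroup.mem_zmultiples_iff.1 (h x₀)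
  refine ⟨c, fun y hys => ?_⟩
  have hy : y ∈ AddSubgroup.closure s := AddSubgroup.subset_closure hys
  let g' : B →+ Q := g - c • π
  have hg' : ∀ x, g' x = g x - c • π x := fun x => rfl
  have hg'0 : g' x₀ = 0 := by rw [hg', hc, sub_self]
  have hg'm : ∀ x, g' x ∈ AddSubgroup.zmultiples (π x) := fun x =>
    sub_mem (h x) (AddSubgroup.zsmul_mem_zmultiples _ _)
  suffices h0 : g' y = 0 by rwa [hg', sub_eq_zero] at h0
  let Z := AddSubgroup.zmultiples (π x₀)
  set m := addOrderOf (QuotientAddGroup.mk (π y) : Q ⧸ Z) with hm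
  have hmdvd : ∀ k : ℤ, k • π y ∈ Z ↔ (m : ℤ) ∣ k := by
    intro k
    rw [hm, addOrderOf_dvd_iff_zsmul_eq_zero, ← QuotientAddGroup.mk_zsmul,
      QuotientAddGroup.eq_zero_iff]
  obtain ⟨b, hb⟩ := AddSubgroup.mem_zmultiples_iff.1 ((hmdvd m).2 dvd_rfl)
  have hmn : (m : ℤ) ∣ n := by
    rw [← hmdvd, natCast_zsmul, hexp y hy]
    exact zero_mem _
  have hnpos : 0 < n := (AddMonoid.ExponentExists.of_finite (G := R)).exponent_pos
  obtain ⟨q, hq⟩ := hmn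
  have hq0 : q ≠ 0 := by
    rintro rfl
    rw [mul_zero] at hq
    omega
  -- The order `n` of `π x₀` is the exponent of `R`. This forces `m ∣ b`, so a shift of `y` by a
  -- multiple of `x₀` makes its image annihilated by `m`.
  have hmb : (m : ℤ) ∣ b := by
    have h1 : (q * b) • π x₀ = 0 := by
      rw [mul_smul, hb, ← mul_smul, mul_comm, ← hq, natCast_zsmul, hexp y hy]
    rw [← addOrderOf_dvd_iff_zsmul_eq_zero, hr, hq, mul_comm] at h1
    exact (mul_dvd_mul_iff_left hq0).1 h1
  obtain ⟨a, rfl⟩ := hmb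
  have hmy' : (m : ℤ) • π (y - a • x₀) = 0 := by
    rw [map_sub, map_zsmul, smul_sub, ← hb, mul_smul, sub_self]
  have hgy : g' y = g' (y - a • x₀) := by rw [map_sub, map_zsmul, hg'0, smul_zero, sub_zero]
  -- As `g'` kills `x₀`, it agrees on `y - a • x₀` and `x₀ + (y - a • x₀)`. Comparing the
  -- multipliers `k` and `l` gives `m ∣ k - l`, and then `n ∣ l`.
  obtain ⟨k, hk⟩ := AddSubgroup.mem_zmultiples_iff.1 (hg'm (y - a • x₀))
  obtain ⟨l, hl⟩ := AddSubgroup.mem_zmultiples_iff.1 (hg'm (x₀ + (y - a • x₀)))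
  rw [map_add, map_add, hg'0, zero_add, ← hk, smul_add] at hl
  have h1 : (k - l) • π (y - a • x₀) = l • π x₀ := by rw [sub_smul, ← hl]; abel
  have h2 : (m : ℤ) ∣ k - l := by
    rw [← hmdvd]
    have : (k - l) • π y = l • π x₀ + ((k - l) * a) • π x₀ := by
      rw [← h1, map_sub, map_zsmul, smul_sub, mul_smul]; abel
    rw [this]
    exact add_mem (AddSubgroup.zsmul_mem_zmultiples _ _) (AddSubgroup.zsmul_mem_zmultiples _ _)
  obtain ⟨d, hd⟩ := h2
  rw [hd, mul_comm, mul_smul, hmy', smul_zero] at h1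
  have h3 := h1.symm
  rw [← addOrderOf_dvd_iff_zsmul_eq_zero, hr] at h3
  obtain ⟨e, rfl⟩ := h3
  have h4 : ((n : ℤ) * e) • π (y - a • x₀) = 0 := by
    rw [mul_comm, mul_smul, natCast_zsmul,
      hexp _ (sub_mem hy (zsmul_mem hx₀ _)), smul_zero]
  rw [hgy, ← hk, ← hl, h4, add_zero, ← h1]

/-- `γ` maps each element of `E` to a multiple of it modulo a fixed finite subgroup. -/
def AlmostPowerOn {B : Type*} [AddCommGroup B] (γ : B →+ B) (E : AddSubgroup B) : Prop :=
  ∃ F : AddSubgroup B, Finite F ∧ ∀ x ∈ E, γ x ∈ F ⊔ AddSubgroup.zmultiples x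

/-- Modulo `F` one integer `c` works for all coordinates of a given `h`, so `γ h - c • h` lies in
the finite group `F^ι`. The integer depends on `h`, but the error group does not. -/
theorem AlmostPowerOn.almostLE_map_compLeft {B : Type*} [AddCommGroup B] (hB : IsAddTorsion B)
    {γ : B →+ B} {E : AddSubgroup B} (hE : AlmostPowerOn γ E) {ι : Type*} [Finite ι]
    {H : AddSubgroup (ι → B)} (hH : ∀ h ∈ H, ∀ i, h i ∈ E) :
    AlmostLE (H.map (γ.compLeft ι)) H := by
  obtain ⟨F, hF, hγ⟩ := hE
  refine ⟨AddSubgroup.pi Set.univ fun _ => F, ?_, ?_⟩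
  · exact Set.Finite.subset (Set.Finite.pi fun _ : ι => Set.toFinite (F : Set B))
      fun x hx i => by simpa using hx i
  · rintro _ ⟨h, hh, rfl⟩
    obtain ⟨c, hc⟩ := exists_uniform_scalar (hB.addSubgroup E)
      (((QuotientAddGroup.mk' F).comp γ).comp E.subtype)
      ((QuotientAddGroup.mk' F).comp E.subtype) (by
        intro x
        obtain ⟨f, hf, z, hz, hs⟩ := AddSubgroup.mem_sup.1 (hγ x x.2)
        obtain ⟨k, rfl⟩ := AddSubgroup.mem_zmultiples_iff.1 hz
        refine AddSubgroup.mem_zmultiples_iff.2 ⟨k, ?_⟩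
        change k • (QuotientAddGroup.mk (x : B) : B ⧸ F) = QuotientAddGroup.mk (γ x)
        rw [← hs, QuotientAddGroup.mk_add, (QuotientAddGroup.eq_zero_iff f).2 hf, zero_add]
        rfl) (Set.finite_range fun i => (⟨h i, hH h hh i⟩ : E))
    have key : ∀ i, γ (h i) - c • h i ∈ F := by
      intro i
      have := hc _ ⟨i, rfl⟩
      change (QuotientAddGroup.mk (γ (h i)) : B ⧸ F) = c • QuotientAddGroup.mk (h i) at this
      rw [← QuotientAddGroup.mk_zsmul, ← sub_eq_zero, ← QuotientAddGroup.mk_sub,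
        QuotientAddGroup.eq_zero_iff] at this
      exact this
    refine AddSubgroup.mem_sup.2 ⟨c • h, zsmul_mem hh c, γ.compLeft ι h - c • h, ?_, by abel⟩
    intro i _
    exact key i

/-- The elements of `H` annihilated by some element of `M`. -/
def torsionPart {B : Type*} [AddCommGroup B] (M : Submonoid ℕ) (H : AddSubgroup B) :
    AddSubgroup B where
  carrier := {h | h ∈ H ∧ ∃ m ∈ M, m • h = 0}
  zero_mem' := ⟨H.zero_mem, 1, M.one_mem, smul_zero _⟩
  add_mem' := by
    rintro x y ⟨hx, m, hm, hmx⟩ ⟨hy, k, hk, hky⟩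
    refine ⟨H.add_mem hx hy, m * k, M.mul_mem hm hk, ?_⟩
    rw [smul_add, mul_smul, mul_smul, hky, smul_comm, hmx, smul_zero, smul_zero, add_zero]
  neg_mem' := by
    rintro x ⟨hx, m, hm, hmx⟩
    exact ⟨H.neg_mem hx, m, hm, by rw [smul_neg, hmx, neg_zero]⟩

theorem mem_torsionPart_powers {B : Type*} [AddCommGroup B] {p : ℕ} {H : AddSubgroup B} {x : B} :
    x ∈ torsionPart (Submonoid.powers p) H ↔ x ∈ H ∧ ∃ k, p ^ k • x = 0 :=
  and_congr_right fun _ => ⟨fun ⟨_, ⟨k, hk⟩, h⟩ => ⟨k, by rw [← h, ← hk]⟩, fun ⟨k, h⟩ => ⟨_, ⟨k, rfl⟩, h⟩⟩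

/-- The submonoid of natural numbers coprime to `n`. -/
def coprimeSubmonoid (n : ℕ) : Submonoid ℕ where
  carrier := {m | m.Coprime n}
  one_mem' := Nat.coprime_one_left n
  mul_mem' := fun ha hb => Nat.Coprime.mul_left ha hb

/-! ### Cyclic `p`-subgroups and finite socles -/

section CyclicPGroup

variable {B : Type*} [AddCommGroup B] {p : ℕ}

/-- Every nonzero subgroup of the cyclic `p`-group generated by `z` contains `p ^ k • z`. -/
theorem inf_zmultiples_eq_bot (hp : p.Prime) {F : AddSubgroup B} {z : B} {k : ℕ}
    (hz : p ^ (k + 1) • z = 0) (hF : p ^ k • z ∉ F) : F ⊓ AddSubgroup.zmultiples z = ⊥ := by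
  rw [eq_bot_iff]
  rintro _ ⟨hx, hc⟩
  obtain ⟨c, rfl⟩ := AddSubgroup.mem_zmultiples_iff.1 hc
  change c • z ∈ F at hx
  rw [AddSubgroup.mem_bot]
  obtain ⟨j, hj, hg⟩ := (Nat.dvd_prime_pow hp).1
    (Int.natCast_dvd_natCast.1 (Int.gcd_dvd_right c ((p ^ (k + 1) : ℕ) : ℤ)))
  have hbez := Int.gcd_eq_gcd_ab c ((p ^ (k + 1) : ℕ) : ℤ)
  rcases Nat.lt_or_ge k j with h | h
  · have hjk : j = k + 1 := le_antisymm hj h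
    have hd := Int.gcd_dvd_left c ((p ^ (k + 1) : ℕ) : ℤ)
    rw [hg, hjk] at hd
    obtain ⟨d, hd⟩ := hd
    rw [hd, mul_comm, mul_smul, natCast_zsmul, hz, smul_zero]
  · exfalso
    apply hF
    have h1 : p ^ j • z ∈ F := by
      rw [← natCast_zsmul, ← hg, hbez, add_smul, mul_comm, mul_smul,
        mul_comm ((p ^ (k + 1) : ℕ) : ℤ), mul_smul _ ((p ^ (k + 1) : ℕ) : ℤ), natCast_zsmul, hz,
        smul_zero, add_zero]
      exact zsmul_mem hx _
    have h2 : p ^ k • z = p ^ (k - j) • (p ^ j • z) := by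
      rw [← mul_smul, ← pow_add, Nat.sub_add_cancel h]
    rw [h2]
    exact nsmul_mem h1 _

/-- A torsion group with finite `p`-socle is finitely generated modulo `p`, by torsion elements. -/
theorem exists_finite_add_smul (hB : IsAddTorsion B) (hsoc : {y : B | p • y = 0}.Finite) :
    ∃ Z : AddSubgroup B, Finite Z ∧ ∀ j, ∀ y, ∃ z ∈ Z, ∃ y', y = z + p ^ j • y' := by
  let P : AddSubgroup B := (nsmulAddMonoidHom (α := B) p).range
  have hfin : Finite (B ⧸ P) := by
    by_contra hinf
    rw [not_finite_iff_infinite] at hinf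
    obtain ⟨t, ht⟩ := Infinite.exists_subset_card_eq (B ⧸ P) ({y : B | p • y = 0}.ncard + 1)
    let s : Set B := Quotient.out '' (t : Set (B ⧸ P))
    let C := AddSubgroup.closure s
    have hC : Finite C := finite_closure_of_isAddTorsion hB (t.finite_toSet.image _)
    let φ : C →+ C := nsmulAddMonoidHom p
    let ψ : C ⧸ φ.range →+ B ⧸ P := QuotientAddGroup.map φ.range P C.subtype (by
      rintro _ ⟨y, rfl⟩
      exact ⟨y, rfl⟩)
    -- On the finite group `C`, multiplication by `p` has kernel and cokernel of equal order, so
    -- `C/pC` is no larger than the `p`-socle.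
    have h1 : φ.range.index = Nat.card φ.ker := by
      have e1 := φ.range.card_mul_index
      have e2 := φ.ker.card_mul_index
      rw [AddSubgroup.index_ker] at e2
      have hpos : 0 < Nat.card φ.range := Nat.card_pos
      nlinarith
    have h2 : Nat.card φ.ker ≤ {y : B | p • y = 0}.ncard := by
      have : Finite {y : B | p • y = 0} := hsoc
      rw [← Nat.card_coe_set_eq]
      refine Nat.card_le_card_of_injective
        (fun y => ⟨y.1.1, congrArg Subtype.val (y.2 : p • y.1 = 0)⟩) ?_
      intro a b hab
      exact Subtype.ext (Subtype.ext (Subtype.mk.inj hab))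
    have h3 : (t : Set (B ⧸ P)) ⊆ Set.range ψ := by
      intro q hq
      refine ⟨QuotientAddGroup.mk ⟨Quotient.out q, AddSubgroup.subset_closure ⟨q, hq, rfl⟩⟩, ?_⟩
      exact Quotient.out_eq' q
    have h4 : (t : Set (B ⧸ P)).ncard ≤ Nat.card (C ⧸ φ.range) :=
      (Set.ncard_le_ncard h3 (Set.finite_range _)).trans (by
        rw [← Set.image_univ, ← Set.ncard_univ]
        exact Set.ncard_image_le Set.finite_univ)
    rw [Set.ncard_coe_finset, ht] at h4
    change _ ≤ φ.range.index at h4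
    omega
  let Z := AddSubgroup.closure (Set.range (Quotient.out : B ⧸ P → B))
  have h1 : ∀ y, ∃ z ∈ Z, ∃ y', y = z + p • y' := by
    intro y
    have hq : (QuotientAddGroup.mk (Quotient.out (QuotientAddGroup.mk y : B ⧸ P)) : B ⧸ P) =
      QuotientAddGroup.mk y := Quotient.out_eq' _
    obtain ⟨y', hy'⟩ := QuotientAddGroup.eq.1 hq
    refine ⟨_, AddSubgroup.subset_closure ⟨QuotientAddGroup.mk y, rfl⟩, y', ?_⟩
    change p • y' = _ at hy'
    rw [hy']
    abel
  refine ⟨Z, finite_closure_of_isAddTorsion hB (Set.finite_range _), fun j => ?_⟩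
  induction j with
  | zero => exact fun y => ⟨0, Z.zero_mem, y, by simp⟩
  | succ j ih =>
    intro y
    obtain ⟨z, hz, y₁, rfl⟩ := ih y
    obtain ⟨z', hz', y₂, rfl⟩ := h1 y₁
    exact ⟨z + p ^ j • z', Z.add_mem hz (nsmul_mem hz' _), y₂, by
      rw [smul_add, pow_succ, mul_smul, add_assoc]⟩

end CyclicPGroup

/-! ### Almost-power action on primary groups -/

section Structure

variable {B : Type*} [AddCommGroup B] {γ : B →+ B} {p : ℕ}

/-- An infinite supply of socle elements of height at least `k` provides a `z` independent of
everything in sight. Both `z` and `x + z` then meet `F` trivially, and independence of `z` makes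
their multipliers act alike on `z`; subtraction leaves the claim for `x`. -/
theorem mem_of_infinite_socle (hB : IsAddTorsion B) {F : AddSubgroup B} (hFfin : Finite F)
    (hF : ∀ u, F ⊓ AddSubgroup.zmultiples u = ⊥ → γ u ∈ F ⊔ AddSubgroup.zmultiples u)
    (hp : p.Prime) {k : ℕ} (hinf : {y : B | p • y = 0 ∧ ∃ z, p ^ k • z = y}.Infinite) {x : B}
    (hx : p ^ (k + 1) • x = 0) : γ x ∈ F ⊔ AddSubgroup.zmultiples x := by
  let F₁ := F ⊔ AddSubgroup.closure {x, γ x}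
  have hF₁ : Finite F₁ := finite_addSubgroup_sup hFfin (finite_closure_of_isAddTorsion hB (by simp))
  have hFF₁ : F ≤ F₁ := le_sup_left
  have hxF₁ : x ∈ F₁ := AddSubgroup.mem_sup_right (AddSubgroup.subset_closure (by simp))
  have hγxF₁ : γ x ∈ F₁ := AddSubgroup.mem_sup_right (AddSubgroup.subset_closure (by simp))
  obtain ⟨y, ⟨hpy, z, rfl⟩, hyF₁⟩ := hinf.exists_notMem_finite (Set.toFinite (F₁ : Set B))
  change p ^ k • z ∉ F₁ at hyF₁
  have hz : p ^ (k + 1) • z = 0 := by rw [pow_succ', mul_smul, hpy]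
  have hγz := hF z (inf_zmultiples_eq_bot hp hz fun h => hyF₁ (hFF₁ h))
  have hγxz := hF (x + z) (inf_zmultiples_eq_bot (k := k) hp (by rw [smul_add, hx, hz, add_zero])
    fun h => hyF₁ (by
      have := F₁.sub_mem (hFF₁ h) (F₁.nsmul_mem hxF₁ (p ^ k))
      simpa [smul_add] using this))
  obtain ⟨f', hf', w', hw', hs'⟩ := AddSubgroup.mem_sup.1 hγz
  obtain ⟨c', rfl⟩ := AddSubgroup.mem_zmultiples_iff.1 hw'
  obtain ⟨f, hf, w, hw, hs⟩ := AddSubgroup.mem_sup.1 hγxz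
  obtain ⟨c, rfl⟩ := AddSubgroup.mem_zmultiples_iff.1 hw
  rw [map_add, ← hs', smul_add] at hs
  have h1 : (c' - c) • z = f + c • x - γ x - f' := by
    rw [sub_smul, sub_sub, eq_sub_iff_add_eq, ← sub_eq_zero]
    rw [← sub_eq_zero] at hs
    rw [← neg_eq_zero, ← hs]
    abel
  have h2 : (c' - c) • z ∈ F₁ ⊓ AddSubgroup.zmultiples z :=
    ⟨by
      rw [h1]
      exact F₁.sub_mem (F₁.sub_mem (F₁.add_mem (hFF₁ hf) (F₁.zsmul_mem hxF₁ _)) hγxF₁) (hFF₁ hf'),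
    AddSubgroup.zsmul_mem_zmultiples _ _⟩
  rw [inf_zmultiples_eq_bot hp hz hyF₁, AddSubgroup.mem_bot, h1] at h2
  refine AddSubgroup.mem_sup.2 ⟨f - f', sub_mem hf hf', c • x, AddSubgroup.zsmul_mem_zmultiples _ _, ?_⟩
  rw [← sub_eq_zero, ← h2]
  abel

/-- An inertial endomorphism leaves invariant each cyclic subgroup of a divisible `p`-subgroup. -/
theorem FinInertial.mem_zmultiples_of_divisible (hγ : FinInertial γ) (hp : p.Prime)
    {D : AddSubgroup B} (hdiv : ∀ d ∈ D, ∃ d' ∈ D, p • d' = d)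
    (htors : ∀ d ∈ D, ∃ k, p ^ k • d = 0) {x : B} (hx : x ∈ D) :
    γ x ∈ AddSubgroup.zmultiples x := by
  classical
  by_cases hx0 : x = 0
  · simp [hx0]
  have : Fact p.Prime := ⟨hp⟩
  choose! r hrD hr using hdiv
  let u : ℕ → B := fun i => r^[i] x
  have huD : ∀ i, u i ∈ D := by
    intro i
    induction i with
    | zero => exact hx
    | succ i ih =>
      change r^[i + 1] x ∈ D
      rw [Function.iterate_succ_apply']
      exact hrD _ ih
  have hu1 : ∀ i, p • u (i + 1) = u i := by
    intro i
    change p • r^[i + 1] x = _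
    rw [Function.iterate_succ_apply']
    exact hr _ (huD i)
  have hu : ∀ j i, p ^ j • u (i + j) = u i := by
    intro j
    induction j with
    | zero => simp
    | succ j ih =>
      intro i
      rw [pow_succ, mul_smul, ← add_assoc, hu1, ih]
  have hux : ∀ j, p ^ j • u j = x := fun j => by
    have := hu j 0
    rwa [zero_add] at this
  have hmono : Monotone fun i => AddSubgroup.zmultiples (u i) := by
    refine monotone_nat_of_le_succ fun i => ?_
    rw [AddSubgroup.zmultiples_le, ← hu1 i]
    exact nsmul_mem (AddSubgroup.mem_zmultiples _) _
  let P := ⨆ i, AddSubgroup.zmultiples (u i)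
  have hPmem : ∀ y, y ∈ P ↔ ∃ i, y ∈ AddSubgroup.zmultiples (u i) := fun y =>
    AddSubgroup.mem_iSup_of_directed hmono.directed_le
  obtain ⟨F, hF, hPF⟩ := hγ P
  have hNP : ∀ y ∈ P, Nat.card F • γ y ∈ P := by
    intro y hy
    obtain ⟨q, hq, f, hf, hs⟩ := AddSubgroup.mem_sup.1 (hPF (AddSubgroup.mem_map_of_mem γ hy))
    have hf0 : Nat.card F • (⟨f, hf⟩ : F) = 0 := card_nsmul_eq_zero'
    replace hf0 : Nat.card F • f = 0 := congrArg Subtype.val hf0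
    rw [← hs, smul_add, hf0, add_zero]
    exact nsmul_mem hq _
  -- Divide by the `p`-part of `|F|` along the chain `u`, and by the rest by inverting it modulo a
  -- power of `p`.
  have hNdiv : ∃ y ∈ P, Nat.card F • y = x := by
    obtain ⟨t, N', hN', hN⟩ := Nat.exists_eq_pow_mul_and_not_dvd (Nat.card_pos (α := F)).ne' p
      hp.ne_one
    obtain ⟨k, hk⟩ := htors _ (huD t)
    have hcop : IsCoprime (N' : ℤ) ((p ^ k : ℕ) : ℤ) :=
      Nat.isCoprime_iff_coprime.2 (((Nat.Prime.coprime_iff_not_dvd hp).2 hN').symm.pow_right k)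
    obtain ⟨a, b, hab⟩ := hcop
    refine ⟨a • u t, (hPmem _).2 ⟨t, AddSubgroup.zsmul_mem_zmultiples _ _⟩, ?_⟩
    have h1 : (a * N') • u t = u t := by
      have : (a * N' + b * ((p ^ k : ℕ) : ℤ)) • u t = u t := by rw [hab, one_smul]
      rwa [add_smul, mul_smul b, natCast_zsmul, hk, smul_zero, add_zero] at this
    rw [hN, mul_smul, ← natCast_zsmul _ N', ← mul_smul, mul_comm, h1]
    exact hux t
  obtain ⟨y, hyP, hyx⟩ := hNdiv
  have hγx : γ x ∈ P := by rw [← hyx, map_nsmul]; exact hNP y hyP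
  obtain ⟨i, hi⟩ := (hPmem _).1 hγx
  obtain ⟨c, hc⟩ := AddSubgroup.mem_zmultiples_iff.1 hi
  have hex := htors x hx
  obtain ⟨n, hn⟩ : ∃ n, Nat.find hex = n + 1 := by
    refine Nat.exists_eq_succ_of_ne_zero fun h0 => hx0 ?_
    have := Nat.find_spec hex
    rwa [h0, pow_zero, one_smul] at this
  have hn1 : p ^ (n + 1) • x = 0 := hn ▸ Nat.find_spec hex
  have hn0 : ¬ p ^ n • x = 0 := Nat.find_min hex (by omega)
  have hui : p ^ i • u i = x := hux i
  have hord : addOrderOf (u i) = p ^ (n + i + 1) := by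
    apply addOrderOf_eq_prime_pow
    · rwa [pow_add, mul_smul, hui]
    · rw [show n + i + 1 = (n + 1) + i by omega, pow_add, mul_smul, hui, hn1]
  -- `p ^ (n + 1)` kills `γ x = c • u i`, whereas `u i` has order `p ^ (n + 1 + i)`. Hence `p ^ i ∣
  -- c`, and `γ x` is a multiple of `p ^ i • u i = x`.
  have hdvd : ((p ^ (n + 1) : ℕ) : ℤ) * ((p ^ i : ℕ) : ℤ) ∣ ((p ^ (n + 1) : ℕ) : ℤ) * c := by
    rw [← Nat.cast_mul, ← pow_add, show n + 1 + i = n + i + 1 by omega, ← hord,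
      addOrderOf_dvd_iff_zsmul_eq_zero, mul_smul, hc, natCast_zsmul, ← map_nsmul, hn1, map_zero]
  rw [mul_dvd_mul_iff_left (by exact_mod_cast (pow_pos hp.pos _).ne')] at hdvd
  obtain ⟨d, rfl⟩ := hdvd
  rw [← hc, mul_comm, mul_smul, natCast_zsmul, hui]
  exact AddSubgroup.zsmul_mem_zmultiples _ _

/-- With a finite socle, `E` is a finite group plus a divisible one. Each cyclic subgroup of the
divisible part is invariant, and the finite part is absorbed into the error group. -/
theorem FinInertial.almostPowerOn_of_finite_socle (hγ : FinInertial γ) (hB : IsAddTorsion B)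
    (hp : p.Prime) {E : AddSubgroup B} (htors : ∀ x ∈ E, ∃ k, p ^ k • x = 0)
    (hsoc : {y | y ∈ E ∧ p • y = 0}.Finite) : AlmostPowerOn γ E := by
  let S : ℕ → Set B := fun j => {y | p • y = 0 ∧ ∃ z ∈ E, p ^ j • z = y}
  have hSfin : ∀ j, (S j).Finite := fun j => hsoc.subset fun y ⟨hy, z, hz, hzy⟩ =>
    ⟨hzy ▸ nsmul_mem hz _, hy⟩
  have hSanti : ∀ i j, i ≤ j → S j ⊆ S i := by
    rintro i j hij y ⟨hy, z, hz, rfl⟩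
    exact ⟨hy, p ^ (j - i) • z, nsmul_mem hz _, by
      rw [← mul_smul, ← pow_add, Nat.add_sub_cancel' hij]⟩
  -- The finite sets `S j` decrease, so they are constant from the index of least cardinality on.
  let j₀ := Function.argmin fun j => (S j).ncard
  have hstab : ∀ j, j₀ ≤ j → S j = S j₀ := fun j hj =>
    Set.eq_of_subset_of_ncard_le (hSanti _ _ hj)
      (Function.argmin_le (fun j => (S j).ncard) j) (hSfin _)
  let D : AddSubgroup B := E.map (nsmulAddMonoidHom (p ^ j₀))
  have hDE : D ≤ E := by
    rintro _ ⟨y, hy, rfl⟩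
    exact nsmul_mem hy _
  have hdiv : ∀ n, ∀ x ∈ D, p ^ n • x = 0 → ∃ x' ∈ D, p • x' = x := by
    intro n
    induction n with
    | zero =>
      intro x _ hx
      rw [pow_zero, one_smul] at hx
      exact ⟨0, D.zero_mem, by simp [hx]⟩
    | succ n ih =>
      intro x hx hx0
      have h1 : p ^ n • x ∈ S j₀ := by
        obtain ⟨e, he, rfl⟩ := hx
        refine ⟨by rw [← mul_smul, ← pow_succ', hx0], p ^ n • e, nsmul_mem he _, ?_⟩
        exact smul_comm _ _ _
      -- Height `j₀ + n + 1` gives `p ^ n • x = p ^ (j₀ + n + 1) • z`, so subtracting `p • p ^ j₀ •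
      -- z` from `x` leaves an element killed by `p ^ n`.
      rw [← hstab (j₀ + (n + 1)) (by omega)] at h1
      obtain ⟨_, z, hz, hzx⟩ := h1
      have hyD : p ^ j₀ • z ∈ D := ⟨z, hz, rfl⟩
      have h2 : p ^ n • (x - p • p ^ j₀ • z) = 0 := by
        rw [smul_sub, ← hzx, sub_eq_zero, ← mul_smul, ← mul_smul]
        congr 1
        ring
      obtain ⟨x', hx', he⟩ := ih _ (sub_mem hx (nsmul_mem hyD _)) h2
      exact ⟨x' + p ^ j₀ • z, add_mem hx' hyD, by rw [smul_add, he]; abel⟩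
  have hpow : ∀ x ∈ D, γ x ∈ AddSubgroup.zmultiples x := fun x hx =>
    hγ.mem_zmultiples_of_divisible hp
      (fun d hd => let ⟨k, hk⟩ := htors d (hDE hd); hdiv k d hd hk)
      (fun d hd => htors d (hDE hd)) hx
  obtain ⟨Z, hZ, hEZ⟩ := exists_finite_add_smul (hB.addSubgroup E) (p := p) (by
    refine Set.Finite.of_finite_image (f := Subtype.val) (hsoc.subset ?_)
      Subtype.val_injective.injOn
    rintro _ ⟨y, hy, rfl⟩
    exact ⟨y.2, congrArg Subtype.val hy⟩)
  have hZ' : Finite (Z.map E.subtype) := finite_addSubgroup_map hZ _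
  refine ⟨Z.map E.subtype ⊔ (Z.map E.subtype).map γ,
    finite_addSubgroup_sup hZ' (finite_addSubgroup_map hZ' _), fun x hx => ?_⟩
  obtain ⟨z, hz, y, hzy⟩ := hEZ j₀ ⟨x, hx⟩
  have hzy : x = z + p ^ j₀ • (y : B) := congrArg Subtype.val hzy
  obtain ⟨c, hc⟩ := AddSubgroup.mem_zmultiples_iff.1 (hpow (p ^ j₀ • (y : B)) ⟨y, y.2, rfl⟩)
  have hzZ : (z : B) ∈ Z.map E.subtype := ⟨z, hz, rfl⟩
  refine AddSubgroup.mem_sup.2 ⟨γ z - c • z,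
    sub_mem (AddSubgroup.mem_sup_right ⟨z, hzZ, rfl⟩) (zsmul_mem (AddSubgroup.mem_sup_left hzZ) _),
    c • x, AddSubgroup.zsmul_mem_zmultiples _ _, ?_⟩
  rw [hzy, map_add, ← hc, smul_add]
  abel

end Structure

/-! ### Inertia on finite powers of a torsion group -/

section Power

variable {B : Type*} [AddCommGroup B] {γ : B →+ B} {p : ℕ}

theorem IsAddTorsion.pi_of_finite (hB : IsAddTorsion B) (ι : Type*) [Finite ι] :
    IsAddTorsion (ι → B) := by
  intro h
  have := Fintype.ofFinite ι
  rw [isOfFinAddOrder_iff_nsmul_eq_zero]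
  refine ⟨∏ i, addOrderOf (h i), Finset.prod_pos fun i _ => (hB (h i)).addOrderOf_pos, ?_⟩
  funext i
  exact addOrderOf_dvd_iff_nsmul_eq_zero.1 (Finset.dvd_prod_of_mem _ (Finset.mem_univ i))

/-- If socle elements of every height abound, `γ` is almost a power on the whole `p`-part. Otherwise
take the least `m` with finitely many socle elements of height at least `m`: `γ` is almost a power
on the elements killed by `p ^ m`, by minimality, and on the `p ^ m`-multiples, which have finite
socle. -/
theorem almostLE_map_primaryPart (hγ : FinInertial γ) (hB : IsAddTorsion B) {F : AddSubgroup B}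
    (hFfin : Finite F)
    (hF : ∀ u, F ⊓ AddSubgroup.zmultiples u = ⊥ → γ u ∈ F ⊔ AddSubgroup.zmultiples u)
    (hp : p.Prime) {ι : Type*} [Finite ι] (H : AddSubgroup (ι → B)) :
    AlmostLE ((torsionPart (Submonoid.powers p) H).map (γ.compLeft ι)) H := by
  classical
  set Hp := torsionPart (Submonoid.powers p) H with hHp
  have hHpH : Hp ≤ H := fun h hh => hh.1
  have hmem : ∀ h ∈ Hp, ∃ k, p ^ k • h = 0 := fun h hh => (mem_torsionPart_powers.1 hh).2
  let Tp := torsionPart (Submonoid.powers p) (⊤ : AddSubgroup B)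
  have hcoord : ∀ h ∈ Hp, ∀ i, h i ∈ Tp := fun h hh i =>
    mem_torsionPart_powers.2 ⟨trivial, (hmem h hh).imp fun k hk => congrFun hk i⟩
  by_cases hall : ∀ k, {y : B | p • y = 0 ∧ ∃ z, p ^ k • z = y}.Infinite
  · have hAP : AlmostPowerOn γ Tp := ⟨F, hFfin, fun x hx => by
      obtain ⟨_, k, hk⟩ := mem_torsionPart_powers.1 hx
      exact mem_of_infinite_socle hB hFfin hF hp (hall k) (by rw [pow_succ', mul_smul, hk, smul_zero])⟩
    exact (hAP.almostLE_map_compLeft hB hcoord).mono le_rfl hHpH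
  · push Not at hall
    have hm := Nat.find_spec hall
    set m := Nat.find hall with hmdef
    let Tm : AddSubgroup B := (nsmulAddMonoidHom (α := B) (p ^ m)).ker
    have hAPm : AlmostPowerOn γ Tm := by
      refine ⟨F, hFfin, fun x hx => ?_⟩
      have hx : p ^ m • x = 0 := hx
      rcases hm0 : m with _ | k
      · rw [hm0, pow_zero, one_smul] at hx
        simp [hx]
      · have := Nat.find_min hall (m := k) (by omega)
        rw [Set.not_finite] at this
        rw [hm0] at hx
        exact mem_of_infinite_socle hB hFfin hF hp this hx
    let E : AddSubgroup B := Tp.map (nsmulAddMonoidHom (p ^ m))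
    have hAPE : AlmostPowerOn γ E := by
      refine hγ.almostPowerOn_of_finite_socle hB hp ?_ (hm.subset ?_)
      · rintro _ ⟨y, hy, rfl⟩
        obtain ⟨_, k, hk⟩ := mem_torsionPart_powers.1 hy
        exact ⟨k, by rw [nsmulAddMonoidHom_apply, smul_comm, hk, smul_zero]⟩
      · rintro _ ⟨⟨y, hy, rfl⟩, h0⟩
        exact ⟨h0, y, rfl⟩
    let Y : AddSubgroup (ι → B) := Hp.map (nsmulAddMonoidHom (p ^ m))
    have hYHp : Y ≤ Hp := by
      rintro _ ⟨y, hy, rfl⟩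
      exact nsmul_mem hy _
    have hBι := hB.pi_of_finite ι
    obtain ⟨Z, hZ, hYZ⟩ := exists_finite_add_smul (hBι.addSubgroup Y) (p := p) (by
      refine Set.Finite.of_finite_image (f := Subtype.val)
        ((Set.Finite.pi fun _ : ι => hm).subset ?_) Subtype.val_injective.injOn
      rintro _ ⟨⟨_, y, hy, rfl⟩, h0, rfl⟩ i _
      exact ⟨congrFun (congrArg Subtype.val h0) i, y i, rfl⟩)
    have hw : ∀ z : Y, ∃ w ∈ Hp, p ^ m • w = z := fun z => z.2
    choose w hwHp hw using hw
    let W := AddSubgroup.closure (w '' (Z : Set Y))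
    have hW : Finite W := finite_closure_of_isAddTorsion hBι ((Set.toFinite (Z : Set Y)).image w)
    let Hm : AddSubgroup (ι → B) := Hp ⊓ (nsmulAddMonoidHom (α := ι → B) (p ^ m)).ker
    -- `Y = p ^ m Hp` has finite socle, so it equals `p ^ m Y` up to a finite `Z`. Lifting `Z` to
    -- `W` splits `Hp` into its `p ^ m`-torsion, `Y` and the finite `W`.
    have hdec : Hp ≤ (Hm ⊔ Y) ⊔ W := by
      intro h hh
      obtain ⟨z, hz, y, hy⟩ := hYZ m ⟨p ^ m • h, h, hh, rfl⟩
      have hy : p ^ m • h = z + p ^ m • (y : ι → B) := congrArg Subtype.val hy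
      refine AddSubgroup.mem_sup.2 ⟨(h - w z - y) + y, add_mem (AddSubgroup.mem_sup_left ⟨?_, ?_⟩)
        (AddSubgroup.mem_sup_right y.2), w z, AddSubgroup.subset_closure ⟨z, hz, rfl⟩, by abel⟩
      · exact Hp.sub_mem (Hp.sub_mem hh (hwHp z)) (hYHp y.2)
      · change p ^ m • (h - w z - y) = 0
        rw [smul_sub, smul_sub, hy, hw]
        abel
    have hm1 : AlmostLE (Hm.map (γ.compLeft ι)) H :=
      (hAPm.almostLE_map_compLeft hB (H := Hm) fun h hh i => congrFun hh.2 i).mono le_rfl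
        (inf_le_left.trans hHpH)
    have hm2 : AlmostLE (Y.map (γ.compLeft ι)) H := by
      refine (hAPE.almostLE_map_compLeft hB ?_).mono le_rfl (hYHp.trans hHpH)
      rintro _ ⟨y, hy, rfl⟩ i
      exact ⟨y i, hcoord y hy i, rfl⟩
    have hm3 : AlmostLE (W.map (γ.compLeft ι)) H := .of_finite (finite_addSubgroup_map hW _)
    refine ((hm1.sup hm2).sup hm3).mono ?_ le_rfl
    rw [← AddSubgroup.map_sup, ← AddSubgroup.map_sup]
    exact AddSubgroup.map_mono hdec

/-- A cyclic group of order coprime to `|F|` meets `F` trivially, so the control property applies to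
it directly. All primes outside a finite set are thus handled at once. -/
theorem almostLE_map_coprimePart (hB : IsAddTorsion B) {F : AddSubgroup B}
    (hFfin : Finite F)
    (hF : ∀ u, F ⊓ AddSubgroup.zmultiples u = ⊥ → γ u ∈ F ⊔ AddSubgroup.zmultiples u)
    {ι : Type*} [Finite ι] (H : AddSubgroup (ι → B)) :
    AlmostLE ((torsionPart (coprimeSubmonoid (Nat.card F)) H).map (γ.compLeft ι)) H := by
  have hAP : AlmostPowerOn γ (torsionPart (coprimeSubmonoid (Nat.card F)) (⊤ : AddSubgroup B)) := by
    refine ⟨F, hFfin, fun x ⟨_, m, hm, hmx⟩ => hF x ?_⟩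
    rw [eq_bot_iff]
    rintro _ ⟨hy, c, rfl⟩
    have h1 : m • (c • x) = 0 := by rw [smul_comm, hmx, smul_zero]
    have h2 : Nat.card F • (⟨c • x, hy⟩ : F) = 0 := card_nsmul_eq_zero'
    replace h2 : Nat.card F • (c • x) = 0 := congrArg Subtype.val h2
    have h3 : addOrderOf (c • x) = 1 := Nat.eq_one_of_dvd_coprimes hm
      (addOrderOf_dvd_of_nsmul_eq_zero h1) (addOrderOf_dvd_of_nsmul_eq_zero h2)
    exact AddMonoid.addOrderOf_eq_one_iff.1 h3
  refine (hAP.almostLE_map_compLeft hB fun h hh i => ?_).mono le_rfl fun h hh => hh.1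
  obtain ⟨_, m, hm, hmx⟩ := hh
  exact ⟨trivial, m, hm, congrFun hmx i⟩

theorem AlmostLE.finset_sup {C κ : Type*} [AddCommGroup C] {W : κ → AddSubgroup C}
    {H : AddSubgroup C} (s : Finset κ) (h : ∀ i ∈ s, AlmostLE (W i) H) : AlmostLE (s.sup W) H := by
  classical
  induction s using Finset.induction_on with
  | empty => exact .of_le (by simp)
  | insert a s _ ih =>
    rw [Finset.sup_insert]
    exact (h a (by simp)).sup (ih fun i hi => h i (by simp [hi]))

theorem le_torsionPart_sup {C : Type*} [AddCommGroup C] (hC : IsAddTorsion C) (H : AddSubgroup C)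
    {N : ℕ} (hN : N ≠ 0) :
    H ≤ torsionPart (coprimeSubmonoid N) H ⊔
      N.primeFactors.sup fun p => torsionPart (Submonoid.powers p) H := by
  set W := torsionPart (coprimeSubmonoid N) H ⊔
      N.primeFactors.sup fun p => torsionPart (Submonoid.powers p) H with hW
  have key : ∀ n : ℕ, n ≠ 0 → ∀ h ∈ H, n • h = 0 → h ∈ W := by
    intro n
    induction n using Nat.recOnPosPrimePosCoprime with
    | zero => exact fun h => absurd rfl h
    | one =>
      intro _ h _ h0
      rw [one_smul] at h0
      rw [h0]
      exact zero_mem _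
    | prime_pow p k hp _ =>
      intro _ h hh h0
      by_cases hpN : p ∣ N
      · exact AddSubgroup.mem_sup_right
          (Finset.le_sup (f := fun p => torsionPart (Submonoid.powers p) H)
            (Nat.mem_primeFactors.2 ⟨hp, hpN, hN⟩) (mem_torsionPart_powers.2 ⟨hh, k, h0⟩))
      · exact AddSubgroup.mem_sup_left ⟨hh, p ^ k,
          ((Nat.Prime.coprime_iff_not_dvd hp).2 hpN).pow_left k, h0⟩
    | coprime a b ha hb hab iha ihb =>
      intro _ h hh h0
      obtain ⟨u, v, huv⟩ := Nat.isCoprime_iff_coprime.2 hab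
      have e : h = u • (a • h) + v • (b • h) := by
        rw [← natCast_zsmul, ← natCast_zsmul, ← mul_smul, ← mul_smul, ← add_smul, huv, one_smul]
      rw [e]
      refine add_mem (zsmul_mem (ihb (by omega) _ (nsmul_mem hh _) ?_) _)
        (zsmul_mem (iha (by omega) _ (nsmul_mem hh _) ?_) _)
      · rw [← mul_smul, mul_comm, h0]
      · rw [← mul_smul, h0]
  exact fun h hh => key _ (hC h).addOrderOf_pos.ne' h hh (addOrderOf_nsmul_eq_zero h)

/-- An inertial endomorphism of a torsion group acts inertially on finite powers of the group. -/
theorem FinInertial.compLeft (hγ : FinInertial γ) (hB : IsAddTorsion B) (ι : Type*) [Finite ι] :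
    FinInertial (γ.compLeft ι) := by
  intro H
  obtain ⟨F, hFfin, hF⟩ := hγ.exists_finite_control hB
  have h := (almostLE_map_coprimePart hB hFfin hF H).sup
    (AlmostLE.finset_sup (Nat.card F).primeFactors fun p hp =>
      almostLE_map_primaryPart hγ hB hFfin hF (Nat.prime_of_mem_primeFactors hp) H)
  refine h.mono ?_ le_rfl
  refine (AddSubgroup.map_mono
    (le_torsionPart_sup (hB.pi_of_finite ι) H (Nat.card_pos (α := F)).ne')).trans ?_
  rw [AddSubgroup.map_sup]
  refine sup_le_sup_left ?_ _
  rw [AddSubgroup.map_le_iff_le_comap]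
  exact Finset.sup_le fun p hp => AddSubgroup.map_le_iff_le_comap.1
    (Finset.le_sup (f := fun p => (torsionPart (Submonoid.powers p) H).map (γ.compLeft ι)) hp)

end Power

/-! ### Generation modulo torsion and splitting of the torsion subgroup -/

section Decomposition

theorem isAddTorsion_torsion (A : Type*) [AddCommGroup A] : IsAddTorsion (AddCommGroup.torsion A) :=
  fun t => AddSubmonoid.isOfFinAddOrder_coe.1 t.2

/-- A torsion-free abelian group of finite rank is finitely generated modulo each `n > 0`. -/
theorem finite_quotient_nsmul {K : Type*} [AddCommGroup K] [IsAddTorsionFree K]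
    (hrank : Module.rank ℤ K < Cardinal.aleph0) {n : ℕ} (hn : 0 < n) :
    Finite (K ⧸ (nsmulAddMonoidHom (α := K) n).range) := by
  have : NeZero n := ⟨hn.ne'⟩
  by_contra hinf
  rw [not_finite_iff_infinite] at hinf
  -- Representatives of finitely many classes span a free group of rank at most that of `K`. Its
  -- quotient modulo `n` has at most `n ^ rank` elements, so one class more is impossible.
  obtain ⟨t, ht⟩ := Infinite.exists_subset_card_eq (K ⧸ (nsmulAddMonoidHom (α := K) n).range)
    (n ^ Module.finrank ℤ K + 1)
  let C : Submodule ℤ K :=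
    Submodule.span ℤ (Quotient.out '' (t : Set (K ⧸ (nsmulAddMonoidHom (α := K) n).range)))
  have : Module.Finite ℤ C := Module.Finite.span_of_finite ℤ (t.finite_toSet.image _)
  have : Module.IsTorsionFree ℤ C := inferInstance
  have : Module.Free ℤ C := inferInstance
  let b := Module.finBasis ℤ C
  have hd : Module.finrank ℤ C ≤ Module.finrank ℤ K :=
    Cardinal.toNat_le_toNat (Submodule.rank_le C) hrank
  have hmem : ∀ q : t, (Quotient.out q.1 : K) ∈ C := fun q => Submodule.subset_span ⟨q, q.2, rfl⟩
  let ψ : t → (Fin (Module.finrank ℤ C) → ZMod n) := fun q i => (b.repr ⟨_, hmem q⟩ i : ℤ)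
  have hψ : Function.Injective ψ := by
    intro q q' h
    have h1 : ∀ i, ∃ z : ℤ, b.repr (⟨_, hmem q'⟩ - ⟨_, hmem q⟩) i = n * z := by
      intro i
      have h2 := congrFun h i
      obtain ⟨z, hz⟩ := (ZMod.intCast_eq_intCast_iff_dvd_sub _ _ _).1 h2
      exact ⟨z, by rw [map_sub]; exact hz⟩
    choose z hz using h1
    have h3 : (⟨_, hmem q'⟩ - ⟨_, hmem q⟩ : C) = n • ∑ i, z i • b i := by
      rw [← b.sum_repr (⟨_, hmem q'⟩ - ⟨_, hmem q⟩ : C), Finset.smul_sum]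
      refine Finset.sum_congr rfl fun i _ => ?_
      rw [hz, mul_smul, natCast_zsmul]
    have h4 : (Quotient.out q'.1 - Quotient.out q.1 : K) ∈ (nsmulAddMonoidHom (α := K) n).range :=
      ⟨((∑ i, z i • b i : C) : K), (congrArg Subtype.val h3).symm⟩
    have h5 : (QuotientAddGroup.mk (Quotient.out q.1) : K ⧸ (nsmulAddMonoidHom (α := K) n).range) =
        QuotientAddGroup.mk (Quotient.out q'.1) := by
      rw [QuotientAddGroup.eq, neg_add_eq_sub]
      exact h4
    have e : ∀ q : K ⧸ (nsmulAddMonoidHom (α := K) n).range,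
      QuotientAddGroup.mk (Quotient.out q) = q := fun q => Quotient.out_eq' q
    rw [e, e] at h5
    exact Subtype.ext h5
  have hcard := Nat.card_le_card_of_injective ψ hψ
  rw [Nat.card_eq_fintype_card, Fintype.card_coe, ht, Nat.card_pi] at hcard
  simp only [Nat.card_zmod, Finset.prod_const, Finset.card_univ, Fintype.card_fin] at hcard
  have := Nat.pow_le_pow_right hn hd
  omega

variable {A : Type*} [AddCommGroup A]

/-- If the torsion-free rank is finite and the torsion subgroup is bounded or the torsion-free
quotient is finitely generated, there is an integer `n` annihilating the torsion subgroup
such that each subgroup is finitely generated modulo its torsion part and its `n`-multiples. In the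
case where the torsion subgroup is unbounded, `n = 0`. -/
theorem exists_finite_generation_mod (hrank : Module.rank ℤ A < Cardinal.aleph0)
    (hA : (∃ n : ℕ, 0 < n ∧ ∀ t ∈ AddCommGroup.torsion A, n • t = 0) ∨
      AddGroup.FG (A ⧸ AddCommGroup.torsion A)) :
    ∃ n : ℕ, (∀ t ∈ AddCommGroup.torsion A, n • t = 0) ∧ ∀ H : AddSubgroup A,
      ∃ S : Set A, S.Finite ∧ S ⊆ H ∧ H ≤ (H ⊓ AddCommGroup.torsion A) ⊔
        H.map (nsmulAddMonoidHom n) ⊔ AddSubgroup.closure S := by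
  suffices h : ∃ n : ℕ, (∀ t ∈ AddCommGroup.torsion A, n • t = 0) ∧
      ∀ K' : AddSubgroup (A ⧸ AddCommGroup.torsion A), ∃ S : Set (A ⧸ AddCommGroup.torsion A),
        S.Finite ∧ S ⊆ K' ∧ K' ≤ K'.map (nsmulAddMonoidHom n) ⊔ AddSubgroup.closure S by
    obtain ⟨n, hn, h⟩ := h
    refine ⟨n, hn, fun H => ?_⟩
    let π := QuotientAddGroup.mk' (AddCommGroup.torsion A)
    obtain ⟨S, hS, hSK, hgen⟩ := h (H.map π)
    choose! l hlH hl using hSK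
    refine ⟨l '' S, hS.image _, ?_, fun x hx => ?_⟩
    · rintro _ ⟨s, hs, rfl⟩
      exact hlH hs
    obtain ⟨_, ⟨_, ⟨y, hy, rfl⟩, rfl⟩, w, hw, hs⟩ :=
      AddSubgroup.mem_sup.1 (hgen (AddSubgroup.mem_map_of_mem π hx))
    have hcl : AddSubgroup.closure S = (AddSubgroup.closure (l '' S)).map π := by
      rw [AddMonoidHom.map_closure, Set.image_image]
      congr 1
      exact ((Set.image_congr fun s hs => hl hs).trans (Set.image_id' _)).symm
    rw [hcl] at hw
    obtain ⟨v, hv, rfl⟩ := hw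
    have hvH : v ∈ H := by
      refine (AddSubgroup.closure_le _).2 ?_ hv
      rintro _ ⟨s, hs, rfl⟩
      exact hlH hs
    refine AddSubgroup.mem_sup.2 ⟨(x - n • y - v) + n • y, add_mem (AddSubgroup.mem_sup_left
      ⟨H.sub_mem (H.sub_mem hx (H.nsmul_mem hy _)) hvH, ?_⟩) (AddSubgroup.mem_sup_right ⟨y, hy, rfl⟩),
      v, hv, by abel⟩
    refine (QuotientAddGroup.eq_zero_iff _).1 ?_
    change π (x - n • y - v) = 0
    rw [map_sub, map_sub, map_nsmul, ← hs, nsmulAddMonoidHom_apply]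
    abel
  rcases hA with ⟨n, hn, hT⟩ | hfg
  · refine ⟨n, hT, fun K' => ?_⟩
    have hr : Module.rank ℤ K' < Cardinal.aleph0 := by
      refine lt_of_le_of_lt ?_ hrank
      refine (Submodule.rank_le K'.toIntSubmodule).trans ?_
      exact LinearMap.rank_le_of_surjective (QuotientAddGroup.mk' _).toIntLinearMap
        (QuotientAddGroup.mk'_surjective _)
    have := finite_quotient_nsmul hr hn
    refine ⟨Subtype.val '' (Set.range (Quotient.out : K' ⧸ (nsmulAddMonoidHom (α := K') n).range → K')),
      (Set.finite_range _).image _, ?_, fun x hx => ?_⟩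
    · rintro _ ⟨y, _, rfl⟩
      exact y.2
    · have hq := Quotient.out_eq' (QuotientAddGroup.mk ⟨x, hx⟩ :
        K' ⧸ (nsmulAddMonoidHom (α := K') n).range)
      obtain ⟨y, hy⟩ := QuotientAddGroup.eq.1 hq
      refine AddSubgroup.mem_sup.2 ⟨n • (y : _), ⟨y, y.2, rfl⟩, _,
        AddSubgroup.subset_closure ⟨_, ⟨QuotientAddGroup.mk ⟨x, hx⟩, rfl⟩, rfl⟩, ?_⟩
      have hy := congrArg Subtype.val hy
      change n • (y : _) = -_ + x at hy
      rw [hy]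
      abel
  -- For `n = 0` annihilation of the torsion is vacuous, and the claim is that subgroups of the
  -- finitely generated quotient are finitely generated.
  · refine ⟨0, fun t _ => zero_smul _ t, fun K' => ?_⟩
    have : Module.Finite ℤ (A ⧸ AddCommGroup.torsion A) := Module.Finite.iff_addGroup_fg.2 hfg
    obtain ⟨S, hS⟩ := (Submodule.fg_iff_addSubgroup_fg _).1
      (IsNoetherian.noetherian K'.toIntSubmodule)
    refine ⟨S, S.finite_toSet, ?_, ?_⟩
    · have := AddSubgroup.subset_closure (k := (S : Set (A ⧸ AddCommGroup.torsion A)))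
      rw [hS] at this
      exact this
    · rw [hS]
      exact le_sup_right

/-- The image of a subgroup under a homomorphism to the torsion subgroup is, up to a finite
subgroup, the image of its torsion part. -/
theorem almostLE_map_torsion {n : ℕ} (hn : ∀ t ∈ AddCommGroup.torsion A, n • t = 0)
    {H : AddSubgroup A} {S : Set A} (hS : S.Finite)
    (hH : H ≤ (H ⊓ AddCommGroup.torsion A) ⊔ H.map (nsmulAddMonoidHom n) ⊔ AddSubgroup.closure S)
    (u : A →+ AddCommGroup.torsion A) :
    AlmostLE (H.map u) ((H ⊓ AddCommGroup.torsion A).map u) := by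
  have hT : IsAddTorsion (AddCommGroup.torsion A) := isAddTorsion_torsion A
  refine ⟨(AddSubgroup.closure S).map u, ?_, (AddSubgroup.map_mono hH).trans ?_⟩
  · rw [AddMonoidHom.map_closure]
    exact finite_closure_of_isAddTorsion hT (hS.image _)
  · rw [AddSubgroup.map_sup, AddSubgroup.map_sup]
    refine sup_le_sup_right (sup_le le_rfl ?_) _
    rintro _ ⟨_, ⟨y, _, rfl⟩, rfl⟩
    rw [nsmulAddMonoidHom_apply, map_nsmul, show n • u y = 0 from Subtype.ext (hn _ (u y).2)]
    exact zero_mem _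

open TensorProduct in
-- This is injectivity of the natural map from `K/nK` to `ZMod n ⊗ K`.
theorem exists_nsmul_of_one_tmul_eq_zero {K : Type*} [AddCommGroup K] {n : ℕ} {k : K}
    (h : (1 : ZMod n) ⊗ₜ[ℤ] k = 0) : ∃ k', n • k' = k := by
  let I : Ideal ℤ := Ideal.span {(n : ℤ)}
  let e : ZMod n ≃ₗ[ℤ] ℤ ⧸ I :=
    (Int.quotientSpanNatEquivZMod n).symm.toAddEquiv.toIntLinearEquiv
  have h1 := congrArg (TensorProduct.quotTensorEquivQuotSMul K I)
    (congrArg (TensorProduct.congr e (LinearEquiv.refl ℤ K)) h)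
  have he : e 1 = Ideal.Quotient.mk I 1 := by
    change (Int.quotientSpanNatEquivZMod n).symm 1 = _
    rw [map_one, map_one]
  rw [TensorProduct.congr_tmul, he, map_zero, map_zero, LinearEquiv.refl_apply,
    TensorProduct.quotTensorEquivQuotSMul_mk_tmul, one_smul, Submodule.Quotient.mk_eq_zero,
    Submodule.ideal_span_singleton_smul] at h1
  obtain ⟨k', _, hk'⟩ := Submodule.mem_smul_pointwise_iff_exists _ _ _ |>.1 h1
  exact ⟨k', by rw [← hk', natCast_zsmul]⟩

theorem exists_section_of_projective {n : ℕ} {Q M : Type*} [AddCommGroup Q] [AddCommGroup M]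
    [Module (ZMod n) M] [Module.Projective (ZMod n) M] (hQ : ∀ q : Q, n • q = 0) (α : Q →+ M)
    (hα : Function.Surjective α) : ∃ s : M →+ Q, ∀ m, α (s m) = m := by
  let _ : Module (ZMod n) Q := AddCommGroup.zmodModule hQ
  obtain ⟨s, hs⟩ := Module.projective_lifting_property (α.toZModLinearMap n) LinearMap.id hα
  exact ⟨s.toAddMonoidHom, fun m => LinearMap.congr_fun hs m⟩

/-- The torsion subgroup is a direct summand if it is annihilated by `n` and its preimage modulo
`n`-multiples is the kernel of an epimorphism onto a projective `ZMod n`-module. -/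
theorem exists_retraction_of_projective {n : ℕ} (hn : ∀ t ∈ AddCommGroup.torsion A, n • t = 0)
    {M : Type*} [AddCommGroup M] [Module (ZMod n) M] [Module.Projective (ZMod n) M] (β : A →+ M)
    (hβsurj : Function.Surjective β) (hβT : ∀ t ∈ AddCommGroup.torsion A, β t = 0)
    (hβker : ∀ a, β a = 0 → ∃ c, a - n • c ∈ AddCommGroup.torsion A) :
    ∃ r : A →+ AddCommGroup.torsion A, ∀ t : AddCommGroup.torsion A, r t = t := by
  let T := AddCommGroup.torsion A
  have hM0 : ∀ m : M, n • m = 0 := fun m => by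
    rw [← Nat.cast_smul_eq_nsmul (ZMod n), ZMod.natCast_self, zero_smul]
  let N : AddSubgroup A := (nsmulAddMonoidHom (α := A) n).range
  let α₀ : A ⧸ N →+ M := QuotientAddGroup.lift N β (by
    rintro _ ⟨a, rfl⟩
    rw [AddMonoidHom.mem_ker, nsmulAddMonoidHom_apply, map_nsmul, hM0])
  have hα : ∀ a : A, α₀ (QuotientAddGroup.mk a) = β a := fun a => rfl
  obtain ⟨s, hs'⟩ := exists_section_of_projective (n := n) (fun q => by
    obtain ⟨a, rfl⟩ := QuotientAddGroup.mk_surjective q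
    rw [← QuotientAddGroup.mk_nsmul, QuotientAddGroup.eq_zero_iff]
    exact ⟨a, rfl⟩) α₀ fun m => (hβsurj m).imp' _ fun a ha => (hα a).trans ha
  let ρ : T →+ A ⧸ N := (QuotientAddGroup.mk' N).comp T.subtype
  -- `T ∩ nA = 0`: for `n > 0`, if `n • a` is torsion then so is `a`, whence `n • a = 0`.
  have hρ : Function.Injective ρ := by
    rw [injective_iff_map_eq_zero]
    rintro ⟨t, ht⟩ h0
    obtain ⟨a, ha⟩ := (QuotientAddGroup.eq_zero_iff t).1 h0
    have ha : n • a = t := ha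
    refine Subtype.ext ?_
    change t = 0
    rcases Nat.eq_zero_or_pos n with rfl | hpos
    · rw [← ha, zero_smul]
    · have haT : a ∈ T := by
        have h1 : IsOfFinAddOrder (n • a) := by rw [ha]; exact ht
        exact (isOfFinAddOrder_nsmul.1 h1).resolve_right hpos.ne'
      rw [← ha, hn a haT]
  -- Subtracting the section maps `A` into the kernel of `α₀`, which is exactly the embedded copy of
  -- `T`.
  let φ : A →+ A ⧸ N := QuotientAddGroup.mk' N - s.comp β
  have hφ : ∀ a, φ a = QuotientAddGroup.mk a - s (β a) := fun a => rfl
  have hφρ : ∀ a, φ a ∈ ρ.range := by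
    intro a
    obtain ⟨b, hb⟩ := QuotientAddGroup.mk_surjective (φ a)
    have h0 : β b = 0 := by
      rw [← hα, hb, hφ, map_sub, hα, hs', sub_self]
    obtain ⟨c, hk'⟩ := hβker b h0
    refine ⟨⟨b - n • c, hk'⟩, ?_⟩
    rw [← hb]
    change (QuotientAddGroup.mk (b - n • c) : A ⧸ N) = _
    rw [QuotientAddGroup.mk_sub, (QuotientAddGroup.eq_zero_iff (N := N) (n • c)).2 ⟨c, rfl⟩,
      sub_zero]
  refine ⟨(AddMonoidHom.ofInjective hρ).symm.toAddMonoidHom.comp (φ.codRestrict _ hφρ), fun t => ?_⟩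
  change (AddMonoidHom.ofInjective hρ).symm _ = t
  rw [AddEquiv.symm_apply_eq]
  refine Subtype.ext ?_
  change φ t = ρ t
  rw [hφ, hβT t t.2, map_zero, sub_zero]
  rfl

open TensorProduct in
/-- The torsion subgroup is a direct summand if it is annihilated by `n` and the group is finitely
generated modulo torsion and `n`-multiples. -/
theorem exists_retraction_torsion {n : ℕ} (hn : ∀ t ∈ AddCommGroup.torsion A, n • t = 0)
    {S : Set A} (hS : S.Finite)
    (hgen : (⊤ : AddSubgroup A) ≤ (⊤ ⊓ AddCommGroup.torsion A) ⊔
      (⊤ : AddSubgroup A).map (nsmulAddMonoidHom n) ⊔ AddSubgroup.closure S) :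
    ∃ r : A →+ AddCommGroup.torsion A, ∀ t : AddCommGroup.torsion A, r t = t := by
  let T := AddCommGroup.torsion A
  let M := ZMod n ⊗[ℤ] (A ⧸ T)
  let β : A →+ M :=
    ((TensorProduct.mk ℤ (ZMod n) (A ⧸ T) 1).toAddMonoidHom).comp (QuotientAddGroup.mk' T)
  have hβ : ∀ a, β a = (1 : ZMod n) ⊗ₜ[ℤ] (QuotientAddGroup.mk a : A ⧸ T) := fun a => rfl
  have hβT : ∀ t ∈ T, β t = 0 := fun t ht => by
    rw [hβ, (QuotientAddGroup.eq_zero_iff t).2 ht, TensorProduct.tmul_zero]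
  have hM0 : ∀ m : M, n • m = 0 := fun m => by
    rw [← Nat.cast_smul_eq_nsmul (ZMod n), ZMod.natCast_self, zero_smul]
  have hβsurj : Function.Surjective β := by
    intro m
    induction m using TensorProduct.induction_on with
    | zero => exact ⟨0, map_zero _⟩
    | tmul c k =>
      obtain ⟨z, rfl⟩ := ZMod.intCast_surjective c
      obtain ⟨a, rfl⟩ := QuotientAddGroup.mk_surjective k
      refine ⟨z • a, ?_⟩
      rw [map_zsmul, hβ, TensorProduct.smul_tmul', zsmul_one]
    | add x y hx hy =>
      obtain ⟨a, rfl⟩ := hx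
      obtain ⟨b, rfl⟩ := hy
      exact ⟨a + b, map_add _ _ _⟩
  have hnoeth : IsNoetherianRing (ZMod n) :=
    isNoetherianRing_of_surjective ℤ (ZMod n) (Int.castRingHom _) ZMod.intCast_surjective
  have hfin : Module.Finite (ZMod n) M := by
    refine ⟨⟨(hS.image β).toFinset, ?_⟩⟩
    rw [eq_top_iff, Set.Finite.coe_toFinset]
    rintro m -
    obtain ⟨a, rfl⟩ := hβsurj m
    have ha := AddSubgroup.mem_map_of_mem β (hgen (AddSubgroup.mem_top a))
    have hle : ((⊤ ⊓ AddCommGroup.torsion A) ⊔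
      (⊤ : AddSubgroup A).map (nsmulAddMonoidHom n) ⊔ AddSubgroup.closure S).map β ≤
        (Submodule.span (ZMod n) (β '' S)).toAddSubgroup := by
      rw [AddSubgroup.map_le_iff_le_comap]
      refine sup_le (sup_le ?_ ?_) ((AddSubgroup.closure_le _).2 ?_)
      · rintro t ⟨-, ht⟩
        rw [AddSubgroup.mem_comap, hβT t ht]
        exact zero_mem _
      · rintro _ ⟨y, -, rfl⟩
        rw [AddSubgroup.mem_comap, nsmulAddMonoidHom_apply, map_nsmul, hM0]
        exact zero_mem _
      · exact fun s hs => Submodule.subset_span ⟨s, hs, rfl⟩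
    exact hle ha
  have hfp : Module.FinitePresentation (ZMod n) M := Module.finitePresentation_of_finite _ _
  -- The torsion-free group `A/T` is flat over `ℤ`, and flatness survives base change to `ZMod n`.
  have hflat : Module.Flat (ZMod n) M := inferInstance
  have hproj : Module.Projective (ZMod n) M := Module.Flat.projective_of_finitePresentation
  refine exists_retraction_of_projective hn β hβsurj hβT fun a ha => ?_
  obtain ⟨k, hk⟩ := exists_nsmul_of_one_tmul_eq_zero ha
  obtain ⟨c, rfl⟩ := QuotientAddGroup.mk_surjective k
  refine ⟨c, (QuotientAddGroup.eq_zero_iff _).1 ?_⟩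
  rw [QuotientAddGroup.mk_sub, QuotientAddGroup.mk_nsmul, hk]
  exact sub_self _

end Decomposition

/-! ### The semidirect decomposition -/

section Semidirect

variable {A : Type*} [AddCommGroup A]

theorem map_mem_torsion (f : AbAut A) {t : A} (ht : t ∈ AddCommGroup.torsion A) :
    f t ∈ AddCommGroup.torsion A :=
  AddMonoidHom.isOfFinAddOrder f.toLinearMap.toAddMonoidHom ht

/-- The restriction of an automorphism to the torsion subgroup. -/
def restrictTorsion (f : AbAut A) : AbAut (AddCommGroup.torsion A) :=
  AddEquiv.toIntLinearEquiv
    { toFun := fun t => ⟨f t, map_mem_torsion f t.2⟩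
      invFun := fun t => ⟨f⁻¹ t, map_mem_torsion f⁻¹ t.2⟩
      left_inv := fun t => Subtype.ext (f.symm_apply_apply t)
      right_inv := fun t => Subtype.ext (f.apply_symm_apply t)
      map_add' := fun s t => Subtype.ext (map_add f (s : A) t) }

theorem coe_restrictTorsion (f : AbAut A) (t : AddCommGroup.torsion A) :
    (restrictTorsion f t : A) = f t := rfl

theorem IsInertial.finInertial_restrictTorsion {f : AbAut A} (hf : IsInertial f.toAddEquiv) :
    FinInertial (restrictTorsion f).toAddEquiv.toAddMonoidHom := by
  intro H
  refine AlmostLE.of_relIndex_ne_zero (isAddTorsion_torsion A) ?_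
  have h := (isInertial_iff_relIndex _).1 hf (H.map (AddCommGroup.torsion A).subtype)
  rw [← AddSubgroup.relIndex_map_map_of_injective _ _ (AddCommGroup.torsion A).subtype_injective]
  rw [AddSubgroup.map_map] at h ⊢
  exact h

/-- The displacement `f - 1` of an automorphism acting trivially modulo torsion. -/
def displacement (f : AbAut A) (hf : ∀ a, f a - a ∈ AddCommGroup.torsion A) :
    A →+ AddCommGroup.torsion A where
  toFun a := ⟨f a - a, hf a⟩
  map_zero' := Subtype.ext (by simp)
  map_add' a b := Subtype.ext (by simp only [map_add, AddSubgroup.coe_add]; abel)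

theorem coe_displacement (f : AbAut A) (hf : ∀ a, f a - a ∈ AddCommGroup.torsion A) (a : A) :
    (displacement f hf a : A) = f a - a := rfl

/-- Write `f = 1 + u` with `u` mapping to `T`. Up to a finite subgroup `u(H)` is `u(H ∩ T)`, which
lies in `f(H ∩ T) + H`, and there inertia on `T` applies. -/
theorem finInertial_of_restrictTorsion {f : AbAut A} (hf : ∀ a, f a - a ∈ AddCommGroup.torsion A)
    (hdec : ∀ (H : AddSubgroup A) (u : A →+ AddCommGroup.torsion A),
      AlmostLE (H.map u) ((H ⊓ AddCommGroup.torsion A).map u))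
    (hres : FinInertial (restrictTorsion f).toAddEquiv.toAddMonoidHom) :
    FinInertial f.toAddEquiv.toAddMonoidHom := by
  intro H
  let T := AddCommGroup.torsion A
  let u := displacement f hf
  have h1 := (hdec H u).map T.subtype
  have h2 := (hres (H.addSubgroupOf T)).map T.subtype
  have hH : (H.addSubgroupOf T).map T.subtype ≤ H := by
    rintro _ ⟨t, ht, rfl⟩
    exact ht
  have h3 : AlmostLE (((H ⊓ T).map u).map T.subtype) H := by
    refine ((h2.mono le_rfl hH).sup (.of_le (le_refl H))).mono ?_ le_rfl
    rintro _ ⟨_, ⟨t, ⟨htH, htT⟩, rfl⟩, rfl⟩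
    change f t - t ∈ _
    exact sub_mem (AddSubgroup.mem_sup_left ⟨_, ⟨⟨t, htT⟩, htH, rfl⟩, rfl⟩)
      (AddSubgroup.mem_sup_right htH)
  refine ((h1.trans h3).sup (.of_le (le_refl H))).mono ?_ le_rfl
  rintro _ ⟨h, hh, rfl⟩
  refine AddSubgroup.mem_sup.2 ⟨f h - h, ⟨_, ⟨h, hh, rfl⟩, rfl⟩, h, hh, sub_add_cancel _ _⟩

variable (r : A →+ AddCommGroup.torsion A)

/-- The endomorphism acting as `g` on the torsion subgroup and as the identity on the kernel of the
retraction `r`. -/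
def extendEnd (g : AddCommGroup.torsion A →+ AddCommGroup.torsion A) : A →+ A :=
  AddMonoidHom.id A - (AddCommGroup.torsion A).subtype.comp r +
    (AddCommGroup.torsion A).subtype.comp (g.comp r)

theorem extendEnd_apply (g : AddCommGroup.torsion A →+ AddCommGroup.torsion A) (a : A) :
    extendEnd r g a = a - r a + g (r a) := rfl

variable {r}

theorem retraction_extendEnd (hr : ∀ t : AddCommGroup.torsion A, r t = t)
    (g : AddCommGroup.torsion A →+ AddCommGroup.torsion A) (a : A) :
    r (extendEnd r g a) = g (r a) := by
  rw [extendEnd_apply, map_add, map_sub, hr, hr, sub_self, zero_add]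

theorem extendEnd_extendEnd (hr : ∀ t : AddCommGroup.torsion A, r t = t)
    (g h : AddCommGroup.torsion A →+ AddCommGroup.torsion A) (a : A) :
    extendEnd r g (extendEnd r h a) = a - r a + g (h (r a)) := by
  rw [extendEnd_apply, retraction_extendEnd hr, extendEnd_apply]
  abel

variable (hr : ∀ t : AddCommGroup.torsion A, r t = t)

/-- The embedding of `Aut(T(A))` into `Aut(A)` given by a retraction onto the torsion subgroup. -/
def extendAut : AbAut (AddCommGroup.torsion A) →* AbAut A where
  toFun g := AddEquiv.toIntLinearEquiv
    { toFun := extendEnd r g.toAddEquiv.toAddMonoidHom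
      invFun := extendEnd r g⁻¹.toAddEquiv.toAddMonoidHom
      left_inv := fun a => by
        rw [extendEnd_extendEnd hr]
        change a - r a + ((g.symm (g (r a)) : AddCommGroup.torsion A) : A) = a
        rw [g.symm_apply_apply, sub_add_cancel]
      right_inv := fun a => by
        rw [extendEnd_extendEnd hr]
        change a - r a + ((g (g.symm (r a)) : AddCommGroup.torsion A) : A) = a
        rw [g.apply_symm_apply, sub_add_cancel]
      map_add' := map_add _ }
  map_one' := LinearEquiv.ext fun a => sub_add_cancel _ _
  map_mul' g h := LinearEquiv.ext fun a =>
    (extendEnd_extendEnd hr g.toAddEquiv.toAddMonoidHom h.toAddEquiv.toAddMonoidHom a).symm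

theorem extendAut_apply (g : AbAut (AddCommGroup.torsion A)) (a : A) :
    extendAut hr g a = a - r a + g (r a) := rfl

theorem extendAut_apply_coe (g : AbAut (AddCommGroup.torsion A)) (t : AddCommGroup.torsion A) :
    extendAut hr g t = g t := by
  rw [extendAut_apply, hr, sub_self, zero_add]

theorem extendAut_sub_mem (g : AbAut (AddCommGroup.torsion A)) (a : A) :
    extendAut hr g a - a ∈ AddCommGroup.torsion A := by
  have : extendAut hr g a - a = ((g (r a) - r a : AddCommGroup.torsion A) : A) := by
    rw [extendAut_apply, AddSubgroup.coe_sub]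
    abel
  rw [this]
  exact Subtype.coe_prop _

theorem extendAut_injective : Function.Injective (extendAut hr) := fun g h hgh =>
  LinearEquiv.ext fun t => Subtype.ext <| by
    rw [← extendAut_apply_coe hr, ← extendAut_apply_coe hr, hgh]

/-- An inertial `f` trivial modulo `T` differs from the extension of its restriction to `T` by an
element of `Σ`. Conversely, such a product restricts to an inertial automorphism of `T`. -/
theorem stabilityGroup_sup_map_eq (hdec : ∀ (H : AddSubgroup A) (u : A →+ AddCommGroup.torsion A),
      AlmostLE (H.map u) ((H ⊓ AddCommGroup.torsion A).map u)) :
    ((stabilityGroup A (AddCommGroup.torsion A) ⊔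
      (IAut (AddCommGroup.torsion A)).map (extendAut hr) : Subgroup (AbAut A)) : Set (AbAut A)) =
      IAutOne A := by
  have hT := isAddTorsion_torsion A
  rw [Subgroup.normal_mul]
  ext f
  constructor
  · rintro ⟨σ, ⟨hσ1, hσ2⟩, _, ⟨g, hg, rfl⟩, rfl⟩
    have hmem : ∀ a, (σ * extendAut hr g) a - a ∈ AddCommGroup.torsion A := fun a => by
      have := add_mem (hσ1 (extendAut hr g a)) (extendAut_sub_mem hr g a)
      rwa [sub_add_sub_cancel] at this
    refine ⟨FinInertial.isInertial (finInertial_of_restrictTorsion hmem hdec ?_), hmem⟩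
    have : restrictTorsion (σ * extendAut hr g) = g := LinearEquiv.ext fun t => Subtype.ext <| by
      rw [coe_restrictTorsion, LinearEquiv.mul_apply, extendAut_apply_coe, hσ2 _ (g t).2]
    change FinInertial (restrictTorsion (σ * extendAut hr g)).toAddEquiv.toAddMonoidHom
    rw [this]
    exact (mem_IAut_iff hT).1 hg
  · rintro ⟨hf, hmem⟩
    have hg : restrictTorsion f ∈ IAut (AddCommGroup.torsion A) :=
      (mem_IAut_iff hT).2 hf.finInertial_restrictTorsion
    have hinv : (extendAut hr (restrictTorsion f))⁻¹ = extendAut hr (restrictTorsion f)⁻¹ :=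
      (map_inv _ _).symm
    refine ⟨f * (extendAut hr (restrictTorsion f))⁻¹, ⟨fun a => ?_, fun t ht => ?_⟩, _,
      ⟨_, hg, rfl⟩, inv_mul_cancel_right _ _⟩
    · rw [hinv, LinearEquiv.mul_apply]
      have := add_mem (hmem (extendAut hr (restrictTorsion f)⁻¹ a))
        (extendAut_sub_mem hr (restrictTorsion f)⁻¹ a)
      rwa [sub_add_sub_cancel] at this
    · rw [hinv, LinearEquiv.mul_apply, extendAut_apply_coe hr _ ⟨t, ht⟩, ← coe_restrictTorsion]
      exact congrArg Subtype.val ((restrictTorsion f).apply_symm_apply ⟨t, ht⟩)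

theorem stabilityGroup_inf_map_eq_bot (K : Subgroup (AbAut (AddCommGroup.torsion A))) :
    stabilityGroup A (AddCommGroup.torsion A) ⊓ K.map (extendAut hr) = ⊥ := by
  rw [eq_bot_iff]
  rintro _ ⟨⟨_, h⟩, g, _, rfl⟩
  have h1 : g = 1 := LinearEquiv.ext fun t => Subtype.ext <| by
    rw [← extendAut_apply_coe hr, h t t.2]
    rfl
  rw [h1, map_one]
  exact one_mem _

end Semidirect

/-! ### The stability group and the conjugation action -/

section StabilityGroup

variable {A : Type*} [AddCommGroup A]

theorem stabilityGroup_mul_apply {X : AddSubgroup A} {σ τ : AbAut A} (hσ : σ ∈ stabilityGroup A X)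
    (hτ : τ ∈ stabilityGroup A X) (a : A) : (σ * τ) a = a + (σ a - a) + (τ a - a) := by
  have h := hσ.2 _ (hτ.1 a)
  rw [map_sub, sub_eq_iff_eq_add] at h
  rw [LinearEquiv.mul_apply, h]
  abel

theorem stabilityGroup_comm {X : AddSubgroup A} {σ τ : AbAut A} (hσ : σ ∈ stabilityGroup A X)
    (hτ : τ ∈ stabilityGroup A X) : σ * τ = τ * σ :=
  LinearEquiv.ext fun a => by
    rw [stabilityGroup_mul_apply hσ hτ, stabilityGroup_mul_apply hτ hσ, add_right_comm]

theorem stabilityGroup_pow_apply {X : AddSubgroup A} {σ : AbAut A} (hσ : σ ∈ stabilityGroup A X)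
    (m : ℕ) (a : A) : (σ ^ m) a = a + m • (σ a - a) := by
  induction m with
  | zero => simp
  | succ m ih =>
    rw [pow_succ, stabilityGroup_mul_apply (pow_mem hσ m) hσ, ih, add_smul, one_smul]
    abel

/-- The displacement of `σ` kills `T`, so its image is finite, and `σ ^ m` has displacement `m • (σ
- 1)`. -/
theorem isOfFinOrder_of_mem_stabilityGroup
    (hdec : ∀ (H : AddSubgroup A) (u : A →+ AddCommGroup.torsion A),
      AlmostLE (H.map u) ((H ⊓ AddCommGroup.torsion A).map u)) {σ : AbAut A}
    (hσ : σ ∈ stabilityGroup A (AddCommGroup.torsion A)) : IsOfFinOrder σ := by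
  obtain ⟨F, hF, hle⟩ := hdec ⊤ (displacement σ hσ.1)
  rw [isOfFinOrder_iff_pow_eq_one]
  refine ⟨Nat.card F, Nat.card_pos, LinearEquiv.ext fun a => ?_⟩
  rw [stabilityGroup_pow_apply hσ]
  have h0 : (⊤ ⊓ AddCommGroup.torsion A).map (displacement σ hσ.1) = ⊥ := by
    rw [eq_bot_iff]
    rintro _ ⟨t, ⟨-, ht⟩, rfl⟩
    refine Subtype.ext ?_
    rw [coe_displacement, hσ.2 t ht, sub_self]
    rfl
  rw [h0, bot_sup_eq] at hle
  have hmem := hle (AddSubgroup.mem_map_of_mem _ (AddSubgroup.mem_top a))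
  have h1 : Nat.card F • (⟨_, hmem⟩ : F) = 0 := card_nsmul_eq_zero'
  have h2 : Nat.card F • (σ a - a) = 0 :=
    congrArg (fun x : F => ((x : AddCommGroup.torsion A) : A)) h1
  rw [h2, add_zero]
  rfl

/-- The displacement of `σ` vanishes on `T` and on `nA`, so its values on `S` determine `σ`. This
embeds `Σ` in `T^S`, with conjugation by `γ` becoming `γ` on each coordinate. -/
theorem isInertial_conjNormal {n : ℕ} (hn : ∀ t ∈ AddCommGroup.torsion A, n • t = 0)
    {S : Set A} (hS : S.Finite)
    (hgen : (⊤ : AddSubgroup A) ≤ (⊤ ⊓ AddCommGroup.torsion A) ⊔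
      (⊤ : AddSubgroup A).map (nsmulAddMonoidHom n) ⊔ AddSubgroup.closure S)
    {γ : AbAut A} (hγ : IsInertial γ.toAddEquiv)
    (hγT : ∀ a, γ a - a ∈ AddCommGroup.torsion A) :
    IsInertial (MulEquiv.toAdditive
      (MulAut.conjNormal γ : MulAut (stabilityGroup A (AddCommGroup.torsion A)))) := by
  have hSfin : Finite S := hS
  have hres := hγ.finInertial_restrictTorsion.compLeft (isAddTorsion_torsion A) S
  let j : Additive (stabilityGroup A (AddCommGroup.torsion A)) →+ (S → AddCommGroup.torsion A) :=
    { toFun := fun σ s => displacement (Additive.toMul σ).1 (Additive.toMul σ).2.1 s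
      map_zero' := funext fun s => Subtype.ext (sub_self _)
      map_add' := fun σ τ => funext fun s => Subtype.ext (by
        change ((Additive.toMul σ).1 * (Additive.toMul τ).1) (s : A) - s = _
        rw [stabilityGroup_mul_apply (Additive.toMul σ).2 (Additive.toMul τ).2]
        change _ = ((Additive.toMul σ).1 (s : A) - s) + ((Additive.toMul τ).1 (s : A) - s)
        abel) }
  refine hres.isInertial_of_injective j ?_ ?_
  · rw [injective_iff_map_eq_zero]
    intro σ hσ
    have hz : displacement (Additive.toMul σ).1 (Additive.toMul σ).2.1 = 0 := by
      have hle : (⊤ : AddSubgroup A) ≤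
          (displacement (Additive.toMul σ).1 (Additive.toMul σ).2.1).ker := by
        refine hgen.trans (sup_le (sup_le ?_ ?_) ((AddSubgroup.closure_le _).2 ?_))
        · rintro t ⟨-, ht⟩
          exact Subtype.ext (sub_eq_zero.2 ((Additive.toMul σ).2.2 t ht))
        · rintro _ ⟨a, -, rfl⟩
          rw [AddMonoidHom.mem_ker, nsmulAddMonoidHom_apply, map_nsmul]
          exact Subtype.ext (hn _ (Subtype.coe_prop _))
        · exact fun s hs => congrFun hσ ⟨s, hs⟩
      ext a : 1
      exact hle (AddSubgroup.mem_top a)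
    refine Additive.toMul.injective (Subtype.ext (LinearEquiv.ext fun a => ?_))
    exact sub_eq_zero.1 (congrArg Subtype.val (DFunLike.congr_fun hz a))
  · intro σ
    funext s
    refine Subtype.ext ?_
    change γ ((Additive.toMul σ).1 (γ⁻¹ (s : A))) - s = γ ((Additive.toMul σ).1 (s : A) - s)
    have h1 : γ (γ⁻¹ (s : A)) = s := γ.apply_symm_apply _
    -- `s` and `γ⁻¹ s` differ by a torsion element, which `σ` fixes, so `σ - 1` takes the same value
    -- at both.
    have h2 : (s : A) - γ⁻¹ (s : A) ∈ AddCommGroup.torsion A := by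
      have := hγT (γ⁻¹ (s : A))
      rwa [h1] at this
    have h3 := (Additive.toMul σ).2.2 _ h2
    rw [map_sub] at h3
    have h4 : (Additive.toMul σ).1 (γ⁻¹ (s : A)) - γ⁻¹ (s : A) = (Additive.toMul σ).1 (s : A) - s := by
      rw [sub_eq_sub_iff_sub_eq_sub, ← neg_sub, h3, neg_sub]
    rw [← h4, map_sub, h1]

end StabilityGroup

theorem theoremC {A : Type*} [AddCommGroup A]
    (hrank : Module.rank ℤ A < Cardinal.aleph0)
    (hA : (∃ n : ℕ, 0 < n ∧ ∀ t ∈ AddCommGroup.torsion A, n • t = 0) ∨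
      AddGroup.FG (A ⧸ AddCommGroup.torsion A)) :
    (∀ σ ∈ stabilityGroup A (AddCommGroup.torsion A),
      ∀ τ ∈ stabilityGroup A (AddCommGroup.torsion A), σ * τ = τ * σ) ∧
    (∀ σ ∈ stabilityGroup A (AddCommGroup.torsion A), IsOfFinOrder σ) ∧
    ∃ Γ₁ : Subgroup (AbAut A),
      IsInternalSemidirect (IAutOne A) (stabilityGroup A (AddCommGroup.torsion A)) Γ₁ ∧
      Nonempty (Γ₁ ≃* IAut (AddCommGroup.torsion A)) ∧
      ∀ γ ∈ Γ₁, IsInertial (MulEquiv.toAdditive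
        (MulAut.conjNormal γ : MulAut (stabilityGroup A (AddCommGroup.torsion A)))) := by
  obtain ⟨n, hn, hgen⟩ := exists_finite_generation_mod hrank hA
  have hdec : ∀ (H : AddSubgroup A) (u : A →+ AddCommGroup.torsion A),
      AlmostLE (H.map u) ((H ⊓ AddCommGroup.torsion A).map u) := fun H u => by
    obtain ⟨S, hS, _, hHS⟩ := hgen H
    exact almostLE_map_torsion hn hS hHS u
  obtain ⟨S, hS, _, hAS⟩ := hgen ⊤
  obtain ⟨r, hr⟩ := exists_retraction_torsion hn hS hAS
  have hsup := stabilityGroup_sup_map_eq hr hdec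
  refine ⟨fun σ hσ τ hτ => stabilityGroup_comm hσ hτ,
    fun σ hσ => isOfFinOrder_of_mem_stabilityGroup hdec hσ,
    (IAut (AddCommGroup.torsion A)).map (extendAut hr),
    ⟨hsup, inferInstance, stabilityGroup_inf_map_eq_bot hr _⟩,
    ⟨((IAut _).equivMapOfInjective _ (extendAut_injective hr)).symm⟩, fun γ hγ => ?_⟩
  have hγ1 : γ ∈ IAutOne A := by
    rw [← hsup]
    exact Subgroup.mem_sup_right hγ
  exact isInertial_conjNormal hn hS hAS hγ1.1 hγ1.2
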